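/- Let $H$ be a Hopf algebra over a field $k$ with comultiplication $\Delta(h)=\sum h_{(1)}\otimes h_{(2)}$ and counit $\varepsilon$. Let $A$ be a nonzero left $H$-module algebra, that is, a unital associative $k$-algebra with a left $H$-module structure such that $h1=\varepsilon(h)1$ and $h(ab)=\sum (h_{(1)}a)(h_{(2)}b)$ for all $h\in H$, $a,b\in A$. Suppose that $A$ is semilocal (the factor ring of $A$ by its Jacobson radical is semisimple Artinian) and $H$-simple (the only two-sided ideals of $A$ that are stable under $H$ are $0$ and $A$). Let $M$ be an object of ${}_H\mathcal M_A$, that is, a $k$-vector space with a right $A$-module structure and a left $H$-module structure such that $h(ma)=\sum (h_{(1)}m)(h_{(2)}a)$ for all $h\in H$, $m\in M$, $a\in A$. Suppose that $M$ is locally $A$-finite, that is, $M$ is the union of those $H$-stable $A$-submodules which are finitely generated over $A$. Then $M$ is a projective right $A$-module. Moreover, $M$ is a free $A$-module if and only if $M/MQ$ is a free right $A/Q$-module for at least one maximal two-sided ideal $Q$ of $A$. -/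

import Mathlib

open scoped TensorProduct

noncomputable section

namespace HopfMod

section Actions

variable (k H : Type*) [Field k] [Ring H] [HopfAlgebra k H]

/-- For a left `H`-module `M` and `m : M`, the `k`-linear map `τ(m) : H → M`, `h ↦ h m`. -/
def orbitMap {M : Type*} [AddCommGroup M] [Module k M] [Module H M] [IsScalarTower k H M]
    (m : M) : H →ₗ[k] M :=
  (LinearMap.toSpanSingleton H M m).restrictScalars k

/-- The `k`-bilinear map `M × A → M`, `(m, a) ↦ m a`, of a right `A`-module `M`. -/
def rightMul (A M : Type*) [Ring A] [Algebra k A] [AddCommGroup M] [Module k M]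
    [Module Aᵐᵒᵖ M] [IsScalarTower k Aᵐᵒᵖ M] : M →ₗ[k] A →ₗ[k] M :=
  haveI : SMulCommClass k Aᵐᵒᵖ M := IsScalarTower.to_smulCommClass
  LinearMap.mk₂ k (fun m a => MulOpposite.op a • m)
    (fun m n a => smul_add _ m n)
    (fun c m a => (smul_comm c (MulOpposite.op a) m).symm)
    (fun m a b => by rw [MulOpposite.op_add, add_smul])
    (fun c m a => by rw [MulOpposite.op_smul, smul_assoc])

/-- `A` is a left `H`-module algebra: `A` is a `k`-algebra and a left `H`-module with
`h 1 = ε(h) 1` and `h (a b) = ∑ (h₍₁₎ a) (h₍₂₎ b)`; equivalently, `a ↦ τ(a)` is a homomorphism of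
unital algebras from `A` to `Hom(H, A)` with the convolution multiplication. -/
class IsModuleAlgebra (A : Type*) [Ring A] [Algebra k A] [Module H A] [IsScalarTower k H A] :
    Prop where
  orbitMap_one : orbitMap k H (1 : A) = Algebra.linearMap k A ∘ₗ Coalgebra.counit
  orbitMap_mul : ∀ a b : A, orbitMap k H (a * b) =
    LinearMap.mul' k A ∘ₗ TensorProduct.map (orbitMap k H a) (orbitMap k H b) ∘ₗ Coalgebra.comul

/-- The compatibility condition defining the objects of `_H𝓜_A`: `M` is a right `A`-module and a
left `H`-module, over the same `k`-vector space structure, with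
`h (m a) = ∑ (h₍₁₎ m) (h₍₂₎ a)`. -/
class IsHopfModule (A M : Type*) [Ring A] [Algebra k A] [Module H A] [IsScalarTower k H A]
    [AddCommGroup M] [Module k M] [Module Aᵐᵒᵖ M] [IsScalarTower k Aᵐᵒᵖ M]
    [Module H M] [IsScalarTower k H M] : Prop where
  orbitMap_smul : ∀ (m : M) (a : A), orbitMap k H (MulOpposite.op a • m) =
    TensorProduct.lift (rightMul k A M) ∘ₗ
      TensorProduct.map (orbitMap k H m) (orbitMap k H a) ∘ₗ Coalgebra.comul

end Actions

/-- A two-sided ideal is `H`-stable if it is an `H`-submodule. -/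
def IsStableIdeal (H : Type*) {A : Type*} [Ring H] [Ring A] [Module H A]
    (I : TwoSidedIdeal A) : Prop :=
  ∀ (h : H) (a : A), a ∈ I → h • a ∈ I

/-- `A` is `H`-simple: it has no nonzero proper `H`-stable two-sided ideals. -/
def IsHSimple (H A : Type*) [Ring H] [Ring A] [Module H A] : Prop :=
  ∀ I : TwoSidedIdeal A, IsStableIdeal H I → I = ⊥ ∨ I = ⊤

/-- A ring is semilocal if its factor ring by the Jacobson radical is semisimple Artinian. -/
def IsSemilocal (A : Type*) [Ring A] : Prop :=
  IsSemisimpleRing (A ⧸ Ring.jacobson A)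

/-- `M` is locally `A`-finite: every element lies in a subobject (an `A`-submodule stable under
`H`) that is finitely generated as an `A`-module, so that `M` is the union of such subobjects. -/
def IsLocallyFinite (H A M : Type*) [Ring H] [Ring A] [AddCommGroup M] [Module Aᵐᵒᵖ M]
    [Module H M] : Prop :=
  ∀ m : M, ∃ N : Submodule Aᵐᵒᵖ M, (∀ (h : H) (x : M), x ∈ N → h • x ∈ N) ∧ N.FG ∧ m ∈ N

section Quotient

variable {A : Type*} [Ring A] (M : Type*) [AddCommGroup M] [Module Aᵐᵒᵖ M] (Q : TwoSidedIdeal A)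

/-- The submodule `M Q` of a right `A`-module `M`, generated by all `m q` with `q ∈ Q`. -/
def mulIdeal : Submodule Aᵐᵒᵖ M :=
  Submodule.span Aᵐᵒᵖ {x | ∃ (m : M), ∃ q ∈ Q, x = MulOpposite.op q • m}

/-- The right action of `A / Q` on `M / M Q`, as a ring homomorphism `A / Q → End(M / M Q)ᵒᵖ`. -/
def quotientAction : A ⧸ Q.asIdeal →+* (AddMonoid.End (M ⧸ mulIdeal M Q))ᵐᵒᵖ :=
  Ideal.Quotient.lift Q.asIdeal
    ((RingHom.op (Module.toAddMonoidEnd Aᵐᵒᵖ (M ⧸ mulIdeal M Q))).comp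
      (RingEquiv.opOp A).toRingHom)
    (by
      intro a ha
      apply MulOpposite.unop_injective
      ext x
      obtain ⟨m, rfl⟩ := Submodule.Quotient.mk_surjective _ x
      change MulOpposite.op a • (Submodule.Quotient.mk m : M ⧸ mulIdeal M Q) = 0
      rw [← Submodule.Quotient.mk_smul, Submodule.Quotient.mk_eq_zero]
      exact Submodule.subset_span ⟨m, a, ha, rfl⟩)

/-- `M / M Q` as a right `A / Q`-module. -/
instance : Module (A ⧸ Q.asIdeal)ᵐᵒᵖ (M ⧸ mulIdeal M Q) :=
  Module.compHom _ ((RingEquiv.opOp (AddMonoid.End (M ⧸ mulIdeal M Q))).symm.toRingHom.comp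
    (RingHom.op (quotientAction M Q)))

theorem op_mk_smul_mk (a : A) (m : M) :
    MulOpposite.op (Ideal.Quotient.mk Q.asIdeal a) • (Submodule.Quotient.mk m : M ⧸ mulIdeal M Q) =
      Submodule.Quotient.mk (MulOpposite.op a • m) :=
  rfl

end Quotient

end HopfMod

end

/-! Right `A`-modules are treated as modules over `R = Aᵐᵒᵖ`, which is again semilocal. For a
maximal left ideal `I` of `R`, the simple module `S = R ⧸ I` has a multiplicity in a finitely
generated `X`, namely the dimension `mult I X` of `Hom(X, S)` over the division ring `End S`. By
Nakayama, `X` is generated by `n` elements as soon as `mult I X ≤ n * mult I R` for all the finitely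
many simple modules.

The heart is `linearIndependent_of_mult_eq`: if a Hopf module `X` is generated by `e₁, …, eₙ` and
equality holds for a single `S`, then the `eⱼ` form a basis. Place `h` in the span of the entries of
a finite comultiplicative matrix `x`. The map `f ↦ (∑ (xₛₜ eⱼ) fⱼₜ)ₛ` from `A^(nr)` to `X^r` is
surjective thanks to the antipode. Both sides have the same multiplicity of `S`, so every map from
`A^(nr)` to `S` kills the kernel, whose coordinates therefore annihilate `S`. Acting by the matrix
on a relation `∑ eⱼ vⱼ = 0` produces elements of this kernel, so `h vⱼ` annihilates `S` for every
`h`. The `H`-stable ideal of all such elements is proper, hence zero by `H`-simplicity.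

For arbitrary finitely generated `X`, choose `S` maximizing `mult I X / mult I R`. A suitable power
of `X` then meets the criterion and is free (`exists_basis_pow`). So `X` is projective, its
multiplicities are proportional to those of `R`, and divisibility at one simple module already gives
freeness.

If `X` is locally finite but not finitely generated, an increasing sequence of finitely generated
subobjects whose multiplicities are congruent modulo `mult K R` has free successive quotients. An
Eilenberg swindle makes its union free. By Zorn, `X` is an extension of a finitely generated
projective by a free module, and a second swindle makes `X` itself free. Hence the criterion with
`Q` matters only for finitely generated `M`, where it yields the divisibility at a simple module
killed by `Q`. -/

open scoped TensorProduct

noncomputable section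

namespace HopfMod

/-! ### Multiplicities of simple modules over a semilocal ring -/

section Multiplicity

variable {R : Type*} [Ring R]

/-- The dimension of `Hom(X, R / I)` over the endomorphism ring of `R / I`. -/
def mult (I : Ideal R) (X : Type*) [AddCommGroup X] [Module R X] : ℕ :=
  Module.finrank (Module.End R (R ⧸ I)) (X →ₗ[R] R ⧸ I)

variable {X Y S : Type*} [AddCommGroup X] [Module R X] [AddCommGroup Y] [Module R Y]
  [AddCommGroup S] [Module R S]

/-- Precomposition with a linear map, linear over the endomorphisms of the target. -/
def precomp (S : Type*) [AddCommGroup S] [Module R S] (f : X →ₗ[R] Y) :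
    (Y →ₗ[R] S) →ₗ[Module.End R S] (X →ₗ[R] S) where
  toFun g := g ∘ₗ f
  map_add' _ _ := rfl
  map_smul' _ _ := rfl

@[simp] theorem precomp_apply (f : X →ₗ[R] Y) (g : Y →ₗ[R] S) : precomp S f g = g ∘ₗ f := rfl

theorem precomp_injective {f : X →ₗ[R] Y} (hf : Function.Surjective f) :
    Function.Injective (precomp S f) := fun g g' h => by
  ext y
  obtain ⟨x, rfl⟩ := hf y
  exact LinearMap.congr_fun h x

theorem precomp_bijective {f : X →ₗ[R] Y}
    (hf : Function.Surjective f) (hker : ∀ x, f x = 0 → ∀ g : X →ₗ[R] S, g x = 0) :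
    Function.Bijective (precomp S f) := by
  refine ⟨precomp_injective hf, fun g => ?_⟩
  refine ⟨(LinearMap.ker f).liftQ g (fun x hx => hker x hx g) ∘ₗ
    (f.quotKerEquivOfSurjective hf).symm.toLinearMap, ?_⟩
  ext x
  have : (f.quotKerEquivOfSurjective hf).symm (f x) = Submodule.Quotient.mk x := by
    rw [LinearEquiv.symm_apply_eq]; rfl
  simp only [precomp_apply, LinearMap.comp_apply, LinearEquiv.coe_coe, this]
  rfl

/-- An isomorphism of modules induces an isomorphism of the duals. -/
def precompEquiv (S : Type*) [AddCommGroup S] [Module R S] (e : X ≃ₗ[R] Y) :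
    (Y →ₗ[R] S) ≃ₗ[Module.End R S] (X →ₗ[R] S) :=
  LinearEquiv.ofLinearMap (precomp S e.toLinearMap) (precomp S e.symm.toLinearMap)
    (by ext; simp) (by ext; simp)

theorem mult_congr (I : Ideal R) (e : X ≃ₗ[R] Y) : mult I X = mult I Y :=
  (precompEquiv (R ⧸ I) e).symm.finrank_eq

/-- The dual of a finite product. -/
def dualPiEquiv (S : Type*) [AddCommGroup S] [Module R S] {ι : Type*} [Fintype ι] [DecidableEq ι]
    (X : ι → Type*) [∀ i, AddCommGroup (X i)] [∀ i, Module R (X i)] :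
    (∀ i, X i →ₗ[R] S) ≃ₗ[Module.End R S] ((∀ i, X i) →ₗ[R] S) :=
  LinearMap.lsum R X (Module.End R S)

/-- By Schur, a nonzero map is an isomorphism, and it generates all the others over `End S`. -/
theorem finite_dual_of_simple [IsSimpleModule R X] [IsSimpleModule R S] :
    Module.Finite (Module.End R S) (X →ₗ[R] S) := by
  by_cases h : ∃ f : X →ₗ[R] S, f ≠ 0
  · obtain ⟨f, hf⟩ := h
    let e := LinearEquiv.ofBijective f (LinearMap.bijective_of_ne_zero hf)
    refine ⟨⟨{f}, ?_⟩⟩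
    rw [eq_top_iff]
    intro g _
    rw [Finset.coe_singleton, Submodule.mem_span_singleton]
    refine ⟨g ∘ₗ e.symm.toLinearMap, ?_⟩
    ext x
    change g (e.symm (e x)) = g x
    simp
  · push Not at h
    have : Subsingleton (X →ₗ[R] S) := ⟨fun f g => by rw [h f, h g]⟩
    infer_instance

instance finite_dual_of_semisimple [IsSemisimpleModule R X] [Module.Finite R X]
    [IsSimpleModule R S] : Module.Finite (Module.End R S) (X →ₗ[R] S) := by
  obtain ⟨n, T, e, hT⟩ := IsSemisimpleModule.exists_linearEquiv_fin_dfinsupp R X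
  let e' := e.trans (DFinsupp.linearEquivFunOnFintype (R := R))
  have := fun i => finite_dual_of_simple (R := R) (X := T i) (S := S)
  exact Module.Finite.equiv ((dualPiEquiv S (fun i => T i)).trans (precompEquiv S e'))

instance (I : Ideal R) [hI : I.IsMaximal] : IsSimpleModule R (R ⧸ I) :=
  isSimpleModule_iff_isCoatom.2 hI.out

/-- The dual with values in a semisimple module only sees the quotient by the radical. -/
def dualRadEquiv (S : Type*) [AddCommGroup S] [Module R S] [IsSemisimpleModule R S] :
    ((X ⧸ Module.jacobson R X) →ₗ[R] S) ≃ₗ[Module.End R S] (X →ₗ[R] S) :=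
  LinearEquiv.ofBijective (precomp S (Module.jacobson R X).mkQ)
    ⟨precomp_injective (Submodule.mkQ_surjective _), fun f =>
      ⟨(Module.jacobson R X).liftQ f (IsSemisimpleModule.jacobson_le_ker R R X S f), by
        ext; rfl⟩⟩

theorem mult_rad (I : Ideal R) [I.IsMaximal] : mult I (X ⧸ Module.jacobson R X) = mult I X :=
  (dualRadEquiv (R ⧸ I)).finrank_eq

/-- A surjection from `R^n` onto `X` carries the radical into the radical, so the quotient is an
image of the semisimple module `(R ⧸ J)^n`. -/
theorem semisimple_rad (hR : IsSemisimpleModule R (R ⧸ Ring.jacobson R)) [Module.Finite R X] :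
    IsSemisimpleModule R (X ⧸ Module.jacobson R X) := by
  obtain ⟨n, f, hf⟩ := Module.Finite.exists_fin' R X
  let g : (Fin n → R ⧸ Ring.jacobson R) →ₗ[R] X ⧸ Module.jacobson R X :=
    LinearMap.lsum R _ ℕ fun i => (Ring.jacobson R).mapQ _
      (f ∘ₗ LinearMap.single R (fun _ : Fin n => R) i)
      (Module.le_comap_jacobson _)
  refine IsSemisimpleModule.of_surjective g fun y => ?_
  obtain ⟨x, rfl⟩ := Submodule.mkQ_surjective _ y
  obtain ⟨v, rfl⟩ := hf x
  refine ⟨fun i => Submodule.Quotient.mk (v i), ?_⟩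
  simp only [g, LinearMap.lsum_apply, LinearMap.sum_apply, LinearMap.comp_apply,
    LinearMap.proj_apply, Submodule.mapQ_apply, Submodule.mkQ_apply]
  conv_rhs => rw [← Submodule.mkQ_apply,
    show v = ∑ i, LinearMap.single R (fun _ : Fin n => R) i (v i) from
    (Finset.univ_sum_single v).symm, map_sum, map_sum]
  rfl

/-- This keeps `finrank` away from its default value `0`, so that multiplicities are true dimensions
and add up. -/
theorem finite_dual (hR : IsSemisimpleModule R (R ⧸ Ring.jacobson R)) [Module.Finite R X]
    [IsSimpleModule R S] : Module.Finite (Module.End R S) (X →ₗ[R] S) := by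
  have := semisimple_rad (X := X) hR
  have := finite_dual_of_semisimple (R := R) (X := X ⧸ Module.jacobson R X) (S := S)
  exact Module.Finite.equiv (dualRadEquiv S)

theorem mult_prod (I : Ideal R) [I.IsMaximal]
    [Module.Finite (Module.End R (R ⧸ I)) (X →ₗ[R] R ⧸ I)]
    [Module.Finite (Module.End R (R ⧸ I)) (Y →ₗ[R] R ⧸ I)] :
    mult I (X × Y) = mult I X + mult I Y := by
  classical
  let _ := Module.End.instDivisionRing (R := R) (M := R ⧸ I)
  rw [mult, mult, mult, ← (LinearMap.coprodEquiv (Module.End R (R ⧸ I))).finrank_eq,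
    Module.finrank_prod]

theorem mult_pi (I : Ideal R) [I.IsMaximal] {ι : Type*} [Fintype ι]
    [Module.Finite (Module.End R (R ⧸ I)) (X →ₗ[R] R ⧸ I)] :
    mult I (ι → X) = Fintype.card ι * mult I X := by
  classical
  let _ := Module.End.instDivisionRing (R := R) (M := R ⧸ I)
  rw [mult, mult, ← (dualPiEquiv (R ⧸ I) (fun _ : ι => X)).finrank_eq,
    Module.finrank_pi_fintype, Finset.sum_const, Finset.card_univ, smul_eq_mul]

theorem mult_pos_iff (I : Ideal R) [I.IsMaximal]
    [Module.Finite (Module.End R (R ⧸ I)) (X →ₗ[R] R ⧸ I)] :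
    0 < mult I X ↔ ∃ f : X →ₗ[R] R ⧸ I, f ≠ 0 := by
  classical
  let _ := Module.End.instDivisionRing (R := R) (M := R ⧸ I)
  rw [mult, Module.finrank_pos_iff, nontrivial_iff_exists_ne 0]

/-- A family of maximal left ideals such that every simple module is isomorphic to the quotient
by one of them. -/
structure IsCompleteFamily {t : Type*} (I : t → Ideal R) : Prop where
  isMaximal : ∀ j, (I j).IsMaximal
  complete : ∀ K : Ideal R, K.IsMaximal → ∃ j, Nonempty ((R ⧸ K) ≃ₗ[R] R ⧸ I j)

theorem IsCompleteFamily.exists_equiv {t : Type*} {I : t → Ideal R} (hI : IsCompleteFamily I)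
    [IsSimpleModule R S] : ∃ j, Nonempty (S ≃ₗ[R] R ⧸ I j) := by
  obtain ⟨K, hK, ⟨e⟩⟩ := isSimpleModule_iff_quot_maximal.1 ‹IsSimpleModule R S›
  obtain ⟨j, ⟨e'⟩⟩ := hI.complete K hK
  exact ⟨j, ⟨e.trans e'⟩⟩

/-- Every simple module is a quotient of `R ⧸ J`, a finite product of simple modules, and some
factor maps to it nontrivially. Repetitions in the family are harmless. -/
theorem exists_completeFamily (hR : IsSemisimpleModule R (R ⧸ Ring.jacobson R)) :
    ∃ (t : ℕ) (I : Fin t → Ideal R), IsCompleteFamily I := by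
  obtain ⟨n, T, e, hT⟩ := IsSemisimpleModule.exists_linearEquiv_fin_dfinsupp R
    (R ⧸ Ring.jacobson R)
  choose I hI e' using fun i => isSimpleModule_iff_quot_maximal.1 (hT i)
  refine ⟨n, I, hI, fun K hK => ?_⟩
  have hle : Ring.jacobson R ≤ K := Ring.jacobson_le_of_isMaximal K
  let π : (R ⧸ Ring.jacobson R) →ₗ[R] R ⧸ K := Submodule.factor hle
  have hπ : Function.Surjective π := Submodule.factor_surjective hle
  let ρ := π ∘ₗ (e.trans (DFinsupp.linearEquivFunOnFintype (R := R))).symm.toLinearMap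
  have hρ : Function.Surjective ρ := hπ.comp (LinearEquiv.surjective _)
  have : ∃ i, ρ ∘ₗ LinearMap.single R (fun i => T i) i ≠ 0 := by
    by_contra! h
    have h0 : ρ = 0 := LinearMap.pi_ext' fun i => by rw [h i, LinearMap.zero_comp]
    have : Nontrivial (R ⧸ K) := IsSimpleModule.nontrivial R _
    obtain ⟨x, hx⟩ := exists_ne (0 : R ⧸ K)
    obtain ⟨y, rfl⟩ := hρ x
    exact hx (by rw [h0, LinearMap.zero_apply])
  obtain ⟨i, hi⟩ := this
  exact ⟨i, ⟨(LinearEquiv.ofBijective _ (LinearMap.bijective_of_ne_zero hi)).symm.trans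
    (e' i).some⟩⟩

/-- A nonzero map from a semisimple to a simple module splits off its target. -/
theorem exists_equiv_ker_prod [IsSemisimpleModule R X] (f : X →ₗ[R] S)
    (hf : Function.Surjective f) : Nonempty (X ≃ₗ[R] LinearMap.ker f × S) := by
  obtain ⟨C, hC⟩ := exists_isCompl (LinearMap.ker f)
  exact ⟨(Submodule.prodEquivOfIsCompl _ _ hC).symm.trans
    ((LinearEquiv.refl R _).prodCongr
      ((Submodule.quotientEquivOfIsCompl _ _ hC).symm.trans (f.quotKerEquivOfSurjective hf)))⟩

/-- Induction on the number of factors: the first factor occurs in `Y`, hence splits off, and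
additivity of multiplicities passes the inequalities to the kernel. -/
theorem exists_surjective_of_simples {t : Type*} {I : t → Ideal R} (hI : IsCompleteFamily I)
    (n : ℕ) (σ : Fin n → t) : ∀ (Y : Type _) [AddCommGroup Y] [Module R Y]
    [IsSemisimpleModule R Y] [Module.Finite R Y],
    (∀ j, mult (I j) (∀ i, R ⧸ I (σ i)) ≤ mult (I j) Y) →
    ∃ f : Y →ₗ[R] ∀ i, R ⧸ I (σ i), Function.Surjective f := by
  have := hI.isMaximal
  induction n with
  | zero => exact fun Y _ _ _ _ _ => ⟨0, fun x => ⟨0, Subsingleton.elim _ _⟩⟩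
  | succ n ih =>
    intro Y _ _ _ _ h
    let e : (∀ i, R ⧸ I (σ i)) ≃ₗ[R] (R ⧸ I (σ 0)) × (∀ i : Fin n, R ⧸ I (σ i.succ)) :=
      (Fin.consLinearEquiv R (fun i => R ⧸ I (σ i))).symm
    have hadd : ∀ j, mult (I j) (∀ i, R ⧸ I (σ i)) =
        mult (I j) (R ⧸ I (σ 0)) + mult (I j) (∀ i : Fin n, R ⧸ I (σ i.succ)) := fun j => by
      rw [mult_congr _ e, mult_prod]
    have hpos : 0 < mult (I (σ 0)) (R ⧸ I (σ 0)) := by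
      rw [mult_pos_iff]
      have : Nontrivial (R ⧸ I (σ 0)) := IsSimpleModule.nontrivial R _
      exact ⟨LinearMap.id, fun h0 => by
        obtain ⟨x, hx⟩ := exists_ne (0 : R ⧸ I (σ 0))
        exact hx (LinearMap.congr_fun h0 x)⟩
    obtain ⟨f, hf⟩ := (mult_pos_iff (X := Y) (I (σ 0))).1 (by
      have := h (σ 0)
      have := hadd (σ 0)
      omega)
    obtain ⟨e'⟩ := exists_equiv_ker_prod f (LinearMap.surjective_of_ne_zero hf)
    have : Module.Finite R (LinearMap.ker f) :=
      Module.Finite.of_surjective (LinearMap.fst R _ _ ∘ₗ e'.toLinearMap)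
        (Prod.fst_surjective.comp e'.surjective)
    obtain ⟨g, hg⟩ := ih (fun i => σ i.succ) (LinearMap.ker f) (fun j => by
      have h1 := h j
      rw [hadd, mult_congr (I j) e', mult_prod] at h1
      omega)
    refine ⟨e.symm.toLinearMap ∘ₗ (LinearMap.id.prodMap g) ∘ₗ
      (LinearEquiv.prodComm R _ _).toLinearMap ∘ₗ e'.toLinearMap, ?_⟩
    exact e.symm.surjective.comp ((Function.surjective_id.prodMap hg).comp
      ((LinearEquiv.prodComm R _ _).surjective.comp e'.surjective))

/-- A semisimple module of finite length whose multiplicities are at most those of `Y` is a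
quotient of `Y`. -/
theorem exists_surjective_of_mult_le {t : Type*} {I : t → Ideal R} (hI : IsCompleteFamily I)
    [IsSemisimpleModule R X] [Module.Finite R X] [IsSemisimpleModule R Y] [Module.Finite R Y]
    (h : ∀ j, mult (I j) X ≤ mult (I j) Y) : ∃ f : Y →ₗ[R] X, Function.Surjective f := by
  obtain ⟨n, T, e, hT⟩ := IsSemisimpleModule.exists_linearEquiv_fin_dfinsupp R X
  choose σ e' using fun i => hI.exists_equiv (S := T i)
  let ε : X ≃ₗ[R] ∀ i, R ⧸ I (σ i) := (e.trans (DFinsupp.linearEquivFunOnFintype (R := R))).trans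
    (LinearEquiv.piCongrRight fun i => (e' i).some)
  obtain ⟨f, hf⟩ := exists_surjective_of_simples hI n σ Y fun j => by
    rw [← mult_congr _ ε]
    exact h j
  exact ⟨ε.symm.toLinearMap ∘ₗ f, ε.symm.surjective.comp hf⟩

/-- Nakayama: a proper range would lie in a maximal submodule, which also contains the radical. -/
theorem surjective_of_mkQ_jacobson [Module.Finite R X] (f : Y →ₗ[R] X)
    (hf : Function.Surjective ((Module.jacobson R X).mkQ ∘ₗ f)) : Function.Surjective f := by
  rw [← LinearMap.range_eq_top]
  by_contra hne
  obtain ⟨m, hm, hle⟩ := (eq_top_or_exists_le_coatom (LinearMap.range f)).resolve_left hne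
  refine hm.1 (eq_top_iff.2 fun x _ => ?_)
  obtain ⟨y, hy⟩ := hf (Submodule.Quotient.mk x)
  have hd : x - f y ∈ Module.jacobson R X := by
    rw [← Submodule.Quotient.mk_eq_zero, Submodule.Quotient.mk_sub, sub_eq_zero]
    exact hy.symm
  have h1 : x - f y ∈ m := (sInf_le (show m ∈ {m : Submodule R X | IsCoatom m} from hm)) hd
  simpa using m.add_mem h1 (hle ⟨y, rfl⟩)

/-- A finitely generated module over a semilocal ring is generated by `n` elements as soon as its
multiplicities allow this. -/
theorem exists_generators (hR : IsSemisimpleModule R (R ⧸ Ring.jacobson R)) {t : Type*}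
    {I : t → Ideal R} (hI : IsCompleteFamily I) [Module.Finite R X] (n : ℕ)
    (h : ∀ j, mult (I j) X ≤ n * mult (I j) R) :
    ∃ f : (Fin n → R) →ₗ[R] X, Function.Surjective f := by
  have := hI.isMaximal
  have := semisimple_rad (X := X) hR
  have hfin := fun j => finite_dual (X := R) (S := R ⧸ I j) hR
  have := semisimple_rad (X := Fin n → R) hR
  obtain ⟨g, hg⟩ := exists_surjective_of_mult_le (X := X ⧸ Module.jacobson R X)
    (Y := (Fin n → R) ⧸ Module.jacobson R (Fin n → R)) hI fun j => by
    rw [mult_rad, mult_rad, mult_pi, Fintype.card_fin]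
    exact h j
  obtain ⟨f, hf⟩ := Module.projective_lifting_property (Module.jacobson R X).mkQ
    (g ∘ₗ (Module.jacobson R (Fin n → R)).mkQ) (Submodule.mkQ_surjective _)
  refine ⟨f, surjective_of_mkQ_jacobson f ?_⟩
  rw [hf]
  exact hg.comp (Submodule.mkQ_surjective _)

theorem mult_self_pos (hR : IsSemisimpleModule R (R ⧸ Ring.jacobson R)) (I : Ideal R)
    [hI : I.IsMaximal] : 0 < mult I R := by
  have := finite_dual (X := R) (S := R ⧸ I) hR
  rw [mult_pos_iff]
  refine ⟨I.mkQ, fun h => hI.ne_top ?_⟩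
  rw [← I.ker_mkQ, h, LinearMap.ker_zero]

end Multiplicity

/-! ### Finite comultiplicative matrices in a coalgebra -/

section Comatrix

variable {k C : Type*} [Field k] [AddCommGroup C] [Module k C] [Coalgebra k C]

/-- Every element of a coalgebra over a field is a linear combination of the entries of a finite
comultiplicative matrix. -/
theorem exists_comatrix (h : C) : ∃ (r : ℕ) (x : Fin r → Fin r → C),
    (∀ s t, Coalgebra.comul (R := k) (x s t) = ∑ u, x s u ⊗ₜ[k] x u t) ∧
    (∀ s t, Coalgebra.counit (R := k) (x s t) = if s = t then (1 : k) else 0) ∧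
    ∃ a : Fin r → Fin r → k, h = ∑ s, ∑ t, a s t • x s t := by
  classical
  -- The range of `φ ↦ (φ ⊗ id) Δ(h)` is a finite-dimensional left coideal containing `h`; the
  -- matrix is that of its coaction.
  let F : Module.Dual k C →ₗ[k] C :=
    { toFun φ := TensorProduct.lid k C (φ.rTensor C (Coalgebra.comul h))
      map_add' φ ψ := by simp [LinearMap.rTensor_add]
      map_smul' c φ := by simp [LinearMap.rTensor_smul] }
  let b := Module.Basis.ofVectorSpace k C
  obtain ⟨y, hy⟩ := TensorProduct.eq_repr_basis_left b (Coalgebra.comul (R := k) h)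
  have hF : ∀ φ, F φ = y.sum fun i m => φ (b i) • m := fun φ => by
    change TensorProduct.lid k C (φ.rTensor C (Coalgebra.comul h)) = _
    rw [← hy, Finsupp.sum, map_sum, map_sum]
    simp [Finsupp.sum]
  have hyF : ∀ i, y i = F (b.coord i) := fun i => by
    rw [hF, Finsupp.sum, Finset.sum_eq_single i]
    · simp
    · intro j _ hj
      simp [hj]
    · intro hi
      simp [Finsupp.notMem_support_iff.1 hi]
  have hfin : Module.Finite k (LinearMap.range F) := by
    have hle : LinearMap.range F ≤ Submodule.span k (y.support.image y : Set C) := by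
      rintro _ ⟨φ, rfl⟩
      rw [hF]
      refine Submodule.sum_mem _ fun i hi => Submodule.smul_mem _ _ (Submodule.subset_span ?_)
      exact Finset.mem_coe.2 (Finset.mem_image_of_mem _ hi)
    exact Submodule.finiteDimensional_of_le hle
  let c := Module.finBasis k (LinearMap.range F)
  obtain ⟨p, hp⟩ := (LinearMap.range F).subtype.exists_leftInverse_of_injective
    (Submodule.ker_subtype _)
  -- The coordinates on the range of `F`, extended to all of `C` by the projection `p`.
  let d : Fin _ → C →ₗ[k] k := fun t => c.coord t ∘ₗ p
  have hd : ∀ s t, d t (c s) = if s = t then 1 else 0 := fun s t => by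
    have : p (c s) = c s := LinearMap.congr_fun hp (c s)
    simp [d, this, Finsupp.single_apply]
  choose φ hφ using fun s => (c s).2
  have hrep : ∀ z ∈ LinearMap.range F, z = ∑ t, d t z • (c t : C) := fun z hz => by
    have h1 : p z = ⟨z, hz⟩ := LinearMap.congr_fun hp ⟨z, hz⟩
    have h2 := congrArg Subtype.val (c.sum_repr ⟨z, hz⟩)
    simp only [Submodule.coe_sum, Submodule.coe_smul] at h2
    simp only [d, LinearMap.comp_apply, h1, Module.Basis.coord_apply, h2]
  obtain ⟨w, hw⟩ : ∃ w : Fin _ → C, Coalgebra.comul (R := k) h = ∑ t, w t ⊗ₜ[k] (c t : C) := by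
    refine ⟨fun t => ∑ i ∈ y.support, d t (y i) • b i, ?_⟩
    rw [← hy, Finsupp.sum]
    simp_rw [TensorProduct.sum_tmul]
    rw [Finset.sum_comm]
    refine Finset.sum_congr rfl fun i _ => ?_
    conv_lhs => rw [hrep (y i) ⟨b.coord i, (hyF i).symm⟩]
    simp_rw [TensorProduct.tmul_sum, TensorProduct.smul_tmul]
  let G : Fin _ → C ⊗[k] C →ₗ[k] C := fun s =>
    (TensorProduct.lid k C).toLinearMap ∘ₗ (φ s).rTensor C
  let x : Fin _ → Fin _ → C := fun s t => G s (Coalgebra.comul (w t))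
  -- Apply `φ s` to the first factor of the coassociativity identity for `h`.
  have hc : ∀ s, Coalgebra.comul (R := k) (c s : C) = ∑ t, x s t ⊗ₜ[k] (c t : C) := fun s => by
    have h1 := congrArg ((TensorProduct.lid k (C ⊗[k] C)).toLinearMap ∘ₗ (φ s).rTensor _)
      (Coalgebra.coassoc_apply (R := k) h)
    have h2 : ∀ z : C ⊗[k] C, (TensorProduct.lid k (C ⊗[k] C)) ((φ s).rTensor (C ⊗[k] C)
        ((Coalgebra.comul (R := k)).lTensor C z)) = Coalgebra.comul (G s z) := fun z => by
      induction z with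
      | zero => simp
      | add a b ha hb => simp only [map_add, ha, hb]
      | tmul a b => simp [G]
    have h3 : ∀ (z : C ⊗[k] C) (c : C), (TensorProduct.lid k (C ⊗[k] C))
        ((φ s).rTensor (C ⊗[k] C) (TensorProduct.assoc k C C C (z ⊗ₜ c))) = G s z ⊗ₜ c :=
      fun z c => by
        induction z with
        | zero => simp
        | add a b ha hb => simp only [map_add, TensorProduct.add_tmul, ha, hb]
        | tmul a b => simp [G, TensorProduct.smul_tmul']
    simp only [LinearMap.comp_apply, LinearEquiv.coe_coe, h2] at h1
    have h4 : G s (Coalgebra.comul h) = c s := hφ s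
    rw [h4] at h1
    rw [← h1, hw]
    simp only [map_sum, LinearMap.rTensor_tmul, h3, x]
  refine ⟨_, x, fun s u => ?_, fun s t => ?_, ?_⟩
  -- Coassociativity for `c s`, comparing the coefficients of `c u` in the last factor.
  · have h1 := congrArg ((((TensorProduct.rid k C).toLinearMap ∘ₗ (d u).lTensor C)).lTensor C)
      (Coalgebra.coassoc_apply (R := k) (c s : C))
    have h2 : ∀ (z : C ⊗[k] C) (c : C),
        (((TensorProduct.rid k C).toLinearMap ∘ₗ (d u).lTensor C)).lTensor C
          (TensorProduct.assoc k C C C (z ⊗ₜ c)) = d u c • z := fun z c => by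
      induction z with
      | zero => simp
      | add a b ha hb => simp only [map_add, TensorProduct.add_tmul, ha, hb, smul_add]
      | tmul a b => simp
    simp [hc, h2, hd, TensorProduct.tmul_sum] at h1
    simpa [TensorProduct.tmul_ite] using h1
  · have h1 := congrArg (fun z => d t (TensorProduct.lid k C z))
      (Coalgebra.rTensor_counit_comul (R := k) (c s : C))
    simpa [hc, hd] using h1
  · have hh : h ∈ LinearMap.range F :=
      ⟨Coalgebra.counit, by simp [F]⟩
    -- The counit in the second factor gives `c s = ∑ₜ ε(c t) x s t`; substitute this into the
    -- expansion of `h`.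
    refine ⟨fun s t => d s h * Coalgebra.counit (R := k) (c t : C), ?_⟩
    conv_lhs => rw [hrep h hh]
    refine Finset.sum_congr rfl fun s _ => ?_
    have h1 := congrArg (TensorProduct.rid k C)
      (Coalgebra.lTensor_counit_comul (R := k) (c s : C))
    simp only [hc, map_sum, LinearMap.lTensor_tmul, TensorProduct.rid_tmul, one_smul] at h1
    simp_rw [mul_smul, ← Finset.smul_sum, h1]

end Comatrix

/-! ### Hopf modules, subobjects and quotients -/

section Compat

variable (k H A : Type*) [Field k] [Ring H] [HopfAlgebra k H] [Ring A] [Algebra k A] [Module H A]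

/-- The part of the axioms of a Hopf module which does not mention a `k`-module structure on the
underlying group. -/
class HopfCompat (X : Type*) [AddCommGroup X] [Module Aᵐᵒᵖ X] [Module H X] : Prop where
  smul_op_smul : ∀ (h : H) (n : ℕ) (x y : Fin n → H),
    Coalgebra.comul (R := k) h = ∑ i, x i ⊗ₜ[k] y i → ∀ (m : X) (a : A),
      h • (MulOpposite.op a • m) = ∑ i, MulOpposite.op (y i • a) • (x i • m)
  algebraMap_smul : ∀ (c : k) (m : X),
    algebraMap k H c • m = MulOpposite.op (algebraMap k A c) • m

variable {k H A} {X Y : Type*} [AddCommGroup X] [Module Aᵐᵒᵖ X] [Module H X]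
  [AddCommGroup Y] [Module Aᵐᵒᵖ Y] [Module H Y]

theorem HopfCompat.of_isHopfModule [IsScalarTower k H A] {M : Type*} [AddCommGroup M] [Module k M]
    [Module Aᵐᵒᵖ M] [IsScalarTower k Aᵐᵒᵖ M] [Module H M] [IsScalarTower k H M]
    [IsHopfModule k H A M] : HopfCompat k H A M where
  smul_op_smul h n x y hxy m a := by
    have := LinearMap.congr_fun (IsHopfModule.orbitMap_smul (k := k) (H := H) m a) h
    simp only [LinearMap.comp_apply, hxy, map_sum, TensorProduct.map_tmul,
      TensorProduct.lift.tmul] at this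
    exact this
  algebraMap_smul c m := by
    rw [_root_.algebraMap_smul, ← _root_.algebraMap_smul Aᵐᵒᵖ c m]
    rfl

theorem HopfCompat.of_injective [HopfCompat k H A Y] (f : X →ₗ[Aᵐᵒᵖ] Y)
    (hf : Function.Injective f) (hH : ∀ (h : H) x, f (h • x) = h • f x) : HopfCompat k H A X where
  smul_op_smul h n x y hxy m a := hf (by
    simp only [hH, map_smul, map_sum, HopfCompat.smul_op_smul h n x y hxy (f m) a])
  algebraMap_smul c m := hf (by
    rw [hH, map_smul, HopfCompat.algebraMap_smul (k := k) (A := A)])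

theorem HopfCompat.of_surjective [HopfCompat k H A X] (f : X →ₗ[Aᵐᵒᵖ] Y)
    (hf : Function.Surjective f) (hH : ∀ (h : H) x, f (h • x) = h • f x) :
    HopfCompat k H A Y where
  smul_op_smul h n x y hxy m a := by
    obtain ⟨m, rfl⟩ := hf m
    simp only [← hH, ← map_smul, ← map_sum, HopfCompat.smul_op_smul h n x y hxy m a]
  algebraMap_smul c m := by
    obtain ⟨m, rfl⟩ := hf m
    rw [← hH, ← map_smul, HopfCompat.algebraMap_smul (k := k) (A := A)]

instance {ι : Type*} [HopfCompat k H A X] : HopfCompat k H A (ι → X) where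
  smul_op_smul h n x y hxy m a := by
    ext i
    simpa using HopfCompat.smul_op_smul h n x y hxy (m i) a
  algebraMap_smul c m := by
    ext i
    simpa using HopfCompat.algebraMap_smul (k := k) (A := A) (H := H) c (m i)

theorem smul_mul_of_comul [IsScalarTower k H A] [IsModuleAlgebra k H A] (h : H) {n : ℕ}
    (x y : Fin n → H) (hxy : Coalgebra.comul (R := k) h = ∑ i, x i ⊗ₜ[k] y i) (a b : A) :
    h • (a * b) = ∑ i, (x i • a) * (y i • b) := by
  have := LinearMap.congr_fun (IsModuleAlgebra.orbitMap_mul (k := k) (H := H) a b) h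
  simp only [LinearMap.comp_apply, hxy, map_sum, TensorProduct.map_tmul,
    LinearMap.mul'_apply] at this
  exact this

end Compat

/-! ### The map attached to a comultiplicative matrix and its surjectivity -/

section ComatrixMap

variable {H A X : Type*} [Ring H] [Ring A] [AddCommGroup X] [Module Aᵐᵒᵖ X] [Module H X]

/-- The map `f ↦ (∑ (xₛₜ eⱼ) fⱼₜ)ₛ` given by a matrix with entries in `H` and a finite family in a
Hopf module. -/
def comatrixMap {n r : ℕ} (x : Fin r → Fin r → H) (e : Fin n → X) :
    (Fin n × Fin r → Aᵐᵒᵖ) →ₗ[Aᵐᵒᵖ] (Fin r → X) :=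
  LinearMap.pi fun s => ∑ p : Fin n × Fin r,
    (LinearMap.toSpanSingleton Aᵐᵒᵖ X (x s p.2 • e p.1)) ∘ₗ LinearMap.proj p

theorem comatrixMap_apply {n r : ℕ} (x : Fin r → Fin r → H) (e : Fin n → X)
    (f : Fin n × Fin r → Aᵐᵒᵖ) (s : Fin r) :
    comatrixMap x e f s = ∑ j, ∑ t, f (j, t) • (x s t • e j) := by
  simp [comatrixMap, Fintype.sum_prod_type]

end ComatrixMap

section Antipode

variable {k H A : Type*} [Field k] [Ring H] [HopfAlgebra k H] [Ring A] [Algebra k A] [Module H A]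
  {X : Type*} [AddCommGroup X] [Module Aᵐᵒᵖ X] [Module H X] [HopfCompat k H A X]

open MulOpposite

/-- The antipode inverts the matrix: `∑ₜ xₛₜ S(xₜᵤ) = δₛᵤ`. The range is a submodule, so it suffices
to reach each generator placed in one coordinate. -/
theorem comatrixMap_surjective {n r : ℕ} (x : Fin r → Fin r → H)
    (hΔ : ∀ s t, Coalgebra.comul (R := k) (x s t) = ∑ u, x s u ⊗ₜ[k] x u t)
    (hε : ∀ s t, Coalgebra.counit (R := k) (x s t) = if s = t then (1 : k) else 0)
    (e : Fin n → X) (he : Submodule.span Aᵐᵒᵖ (Set.range e) = ⊤) :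
    Function.Surjective (comatrixMap (A := A) x e) := by
  classical
  rw [← LinearMap.range_eq_top]
  have hsingle : ∀ (s : Fin r) (m : X),
      Pi.single s m ∈ LinearMap.range (comatrixMap (A := A) x e) := by
    intro s₀ m
    have hm : m ∈ Submodule.span Aᵐᵒᵖ (Set.range e) := he ▸ Submodule.mem_top
    induction hm using Submodule.span_induction with
    | zero => rw [Pi.single_zero]; exact zero_mem _
    | add a b _ _ ha hb => rw [Pi.single_add]; exact add_mem ha hb
    | smul c a _ ha => rw [Pi.single_smul]; exact Submodule.smul_mem _ _ ha
    | mem m hm =>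
      obtain ⟨i, rfl⟩ := hm
      have hb : ∀ t, ∃ b : Fin n → Aᵐᵒᵖ,
          ∑ j, b j • e j = HopfAlgebra.antipode k (x t s₀) • e i := fun t =>
        (Submodule.mem_span_range_iff_exists_fun Aᵐᵒᵖ).1 (he ▸ Submodule.mem_top)
      choose b hb using hb
      -- Obtained by writing `S(xₜₛ₀) eᵢ = ∑ⱼ eⱼ bₜⱼ`, applying `xₛₜ` and summing over `t`: the left
      -- side collapses to `δ eᵢ`, the right side expands through `Δ(xₛₜ)`.
      refine ⟨fun p => ∑ t, op (x p.2 t • unop (b t p.1)), ?_⟩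
      ext s
      rw [comatrixMap_apply]
      have h1 : ∀ t, x s t • (HopfAlgebra.antipode k (x t s₀) • e i) =
          ∑ j, ∑ u, op (x u t • unop (b t j)) • (x s u • e j) := fun t => by
        rw [← hb t, Finset.smul_sum]
        refine Finset.sum_congr rfl fun j _ => ?_
        have := HopfCompat.smul_op_smul (k := k) (x s t) r _ _ (hΔ s t) (e j) (unop (b t j))
        simpa using this
      have h2 : ∑ t, x s t * HopfAlgebra.antipode k (x t s₀) =
          algebraMap k H (if s = s₀ then 1 else 0) := by
        have := HopfAlgebra.mul_antipode_lTensor_comul_apply (R := k) (x s s₀)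
        rw [hΔ, hε] at this
        simpa using this
      have h3 : ∑ t, x s t • (HopfAlgebra.antipode k (x t s₀) • e i) =
          (Pi.single s₀ (e i) : Fin r → X) s := by
        simp_rw [← mul_smul]
        rw [← Finset.sum_smul, h2, HopfCompat.algebraMap_smul (A := A), Pi.single_apply]
        split <;> simp
      rw [← h3]
      simp_rw [h1, Finset.sum_smul]
      rw [Finset.sum_comm (γ := Fin r) (s := Finset.univ (α := Fin r))]
      exact Finset.sum_congr rfl fun j _ => Finset.sum_comm
  refine eq_top_iff.2 fun v _ => ?_
  rw [← Finset.univ_sum_single v]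
  exact sum_mem fun s _ => hsingle s _

end Antipode

/-! ### The freeness criterion over an `H`-simple algebra -/

section Freeness

variable {k H A : Type*} [Field k] [Ring H] [HopfAlgebra k H] [Ring A] [Algebra k A] [Module H A]
  [IsScalarTower k H A]

open MulOpposite

theorem algebraMap_smul_mem_of_twoSided (I : TwoSidedIdeal A) (h : H) (c : k) (a : A)
    (ha : h • a ∈ I) : (c • h) • a ∈ I := by
  rw [smul_assoc, Algebra.smul_def]
  exact I.mul_mem_left _ _ ha

/-- The annihilator of a right module, as a two-sided ideal. -/
def rightAnn (A S : Type*) [Ring A] [AddCommGroup S] [Module Aᵐᵒᵖ S] : TwoSidedIdeal A :=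
  TwoSidedIdeal.mk' {a | ∀ s : S, op a • s = 0} (by simp)
    (fun {a b} ha hb s => by rw [op_add, add_smul, ha s, hb s, add_zero])
    (fun {a} ha s => by rw [op_neg, neg_smul, ha s, neg_zero])
    (fun {a b} hb s => by rw [op_mul, mul_smul, hb])
    (fun {a b} ha s => by rw [op_mul, mul_smul, ha, smul_zero])

theorem mem_rightAnn {S : Type*} [AddCommGroup S] [Module Aᵐᵒᵖ S] {a : A} :
    a ∈ rightAnn A S ↔ ∀ s : S, op a • s = 0 :=
  TwoSidedIdeal.mem_mk' _ _ _ _ _ _ _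

theorem exists_comul_fin (h : H) : ∃ (n : ℕ) (x y : Fin n → H),
    Coalgebra.comul (R := k) h = ∑ i, x i ⊗ₜ[k] y i := by
  obtain ⟨s, hs⟩ := TensorProduct.exists_finset (R := k) (Coalgebra.comul (R := k) h)
  refine ⟨s.card, fun i => (s.equivFin.symm i).1.1, fun i => (s.equivFin.symm i).1.2, ?_⟩
  rw [hs, ← Finset.sum_coe_sort, ← s.equivFin.symm.sum_comp]

/-- The largest `H`-stable ideal contained in a two-sided ideal. -/
def stableCore (k H : Type*) {A : Type*} [Field k] [Ring H] [HopfAlgebra k H] [Ring A]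
    [Algebra k A] [Module H A]
    [IsScalarTower k H A] [IsModuleAlgebra k H A] (I : TwoSidedIdeal A) : TwoSidedIdeal A :=
  TwoSidedIdeal.mk' {a | ∀ h : H, h • a ∈ I} (fun h => by rw [smul_zero]; exact I.zero_mem)
    (fun {a b} ha hb h => by rw [smul_add]; exact I.add_mem (ha h) (hb h))
    (fun {a} ha h => by rw [smul_neg]; exact I.neg_mem (ha h))
    (fun {a b} hb h => by
      obtain ⟨n, x, y, hxy⟩ := exists_comul_fin (k := k) h
      rw [smul_mul_of_comul h x y hxy]
      exact sum_mem fun i _ => I.mul_mem_left _ _ (hb _))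
    (fun {a b} ha h => by
      obtain ⟨n, x, y, hxy⟩ := exists_comul_fin (k := k) h
      rw [smul_mul_of_comul h x y hxy]
      exact sum_mem fun i _ => I.mul_mem_right _ _ (ha _))

theorem mem_stableCore [IsModuleAlgebra k H A] {I : TwoSidedIdeal A} {a : A} :
    a ∈ stableCore k H I ↔ ∀ h : H, h • a ∈ I :=
  TwoSidedIdeal.mem_mk' _ _ _ _ _ _ _

/-- The core is an `H`-stable ideal, and taking `h = 1` shows that it lies inside `I`. -/
theorem stableCore_eq_bot [IsModuleAlgebra k H A] (hA : IsHSimple H A) {I : TwoSidedIdeal A}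
    (hI : (1 : A) ∉ I) : stableCore k H I = ⊥ := by
  refine (hA (stableCore k H I) fun h a ha => ?_).resolve_right fun htop => hI ?_
  · rw [mem_stableCore] at ha ⊢
    intro h'
    rw [← mul_smul]
    exact ha _
  · have : (1 : A) ∈ stableCore k H I := by rw [htop]; trivial
    simpa using mem_stableCore.1 this 1

variable {X : Type*} [AddCommGroup X] [Module Aᵐᵒᵖ X] [Module H X] [HopfCompat k H A X]

/-- Generators of a Hopf module over an `H`-simple module algebra form a basis when one simple
module has the expected multiplicity. -/
theorem linearIndependent_of_mult_eq [IsModuleAlgebra k H A] (hA : IsHSimple H A) (I : Ideal Aᵐᵒᵖ)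
    [I.IsMaximal] [Module.Finite (Module.End Aᵐᵒᵖ (Aᵐᵒᵖ ⧸ I)) (Aᵐᵒᵖ →ₗ[Aᵐᵒᵖ] Aᵐᵒᵖ ⧸ I)]
    [Module.Finite (Module.End Aᵐᵒᵖ (Aᵐᵒᵖ ⧸ I)) (X →ₗ[Aᵐᵒᵖ] Aᵐᵒᵖ ⧸ I)]
    {n : ℕ} (e : Fin n → X) (he : Submodule.span Aᵐᵒᵖ (Set.range e) = ⊤)
    (hmult : mult I X = n * mult I Aᵐᵒᵖ) : LinearIndependent Aᵐᵒᵖ e := by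
  classical
  let _ := Module.End.instDivisionRing (R := Aᵐᵒᵖ) (M := Aᵐᵒᵖ ⧸ I)
  have hnt : Nontrivial (Aᵐᵒᵖ ⧸ I) := IsSimpleModule.nontrivial Aᵐᵒᵖ _
  have hone : (1 : A) ∉ rightAnn A (Aᵐᵒᵖ ⧸ I) := fun h => by
    obtain ⟨s, hs⟩ := exists_ne (0 : Aᵐᵒᵖ ⧸ I)
    exact hs (by simpa using mem_rightAnn.1 h s)
  rw [Fintype.linearIndependent_iff]
  intro v hv j
  have hv0 : unop (v j) ∈ stableCore k H (rightAnn A (Aᵐᵒᵖ ⧸ I)) := by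
    rw [mem_stableCore]
    intro h
    obtain ⟨r, x, hΔ, hε, c, rfl⟩ := exists_comatrix (k := k) h
    have hsurj := comatrixMap_surjective (A := A) x hΔ hε e he
    -- The dual map is injective between spaces of equal finite dimension `n * r * mult I Aᵐᵒᵖ`.
    have hbij : Function.Surjective (precomp (Aᵐᵒᵖ ⧸ I) (comatrixMap (A := A) x e)) := by
      have hfin1 : Module.Finite (Module.End Aᵐᵒᵖ (Aᵐᵒᵖ ⧸ I))
          ((Fin n × Fin r → Aᵐᵒᵖ) →ₗ[Aᵐᵒᵖ] Aᵐᵒᵖ ⧸ I) :=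
        Module.Finite.equiv (dualPiEquiv (Aᵐᵒᵖ ⧸ I) fun _ : Fin n × Fin r => Aᵐᵒᵖ)
      have hfin2 : Module.Finite (Module.End Aᵐᵒᵖ (Aᵐᵒᵖ ⧸ I))
          ((Fin r → X) →ₗ[Aᵐᵒᵖ] Aᵐᵒᵖ ⧸ I) :=
        Module.Finite.equiv (dualPiEquiv (Aᵐᵒᵖ ⧸ I) fun _ : Fin r => X)
      have hdim : mult I (Fin r → X) = mult I (Fin n × Fin r → Aᵐᵒᵖ) := by
        rw [mult_pi, mult_pi, hmult, Fintype.card_prod, Fintype.card_fin, Fintype.card_fin]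
        ring
      exact (LinearMap.injective_iff_surjective_of_finrank_eq_finrank hdim).1
        (precomp_injective hsurj)
    have hker : ∀ f, comatrixMap (A := A) x e f = 0 → ∀ p,
        unop (f p) ∈ rightAnn A (Aᵐᵒᵖ ⧸ I) := fun f hf p => by
      rw [mem_rightAnn]
      intro s
      -- The map `f ↦ s fₚ` factors through `X^r`, so it vanishes on the kernel.
      obtain ⟨g, hg⟩ := hbij (LinearMap.toSpanSingleton Aᵐᵒᵖ _ s ∘ₗ LinearMap.proj p)
      have := LinearMap.congr_fun hg f
      rw [precomp_apply, LinearMap.comp_apply, hf, map_zero] at this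
      exact this.symm
    rw [Finset.sum_smul]
    refine sum_mem fun s _ => ?_
    rw [Finset.sum_smul]
    refine sum_mem fun t _ => algebraMap_smul_mem_of_twoSided _ _ _ _ ?_
    refine hker (fun p => op (x p.2 t • unop (v p.1))) ?_ (j, s)
    ext s'
    -- Expanding `xₛ'ₜ (∑ eⱼ vⱼ) = 0` by comultiplicativity says exactly that this vector lies in
    -- the kernel; its entry at `(j, s)` is `xₛₜ vⱼ`.
    rw [comatrixMap_apply]
    have h1 := congrArg (x s' t • ·) hv
    simp only [Finset.smul_sum, smul_zero] at h1
    rw [Pi.zero_apply, ← h1]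
    refine Finset.sum_congr rfl fun j _ => ?_
    have := HopfCompat.smul_op_smul (k := k) (x s' t) r _ _ (hΔ s' t) (e j) (unop (v j))
    simpa using this.symm
  rw [stableCore_eq_bot hA hone, TwoSidedIdeal.mem_bot] at hv0
  exact unop_injective hv0

end Freeness

/-! ### Splittings and the Eilenberg swindle -/

section Swindle

variable {R : Type*} [Ring R] {P F X : Type*} [AddCommGroup P] [Module R P] [AddCommGroup F]
  [Module R F] [AddCommGroup X] [Module R X]

/-- Surjections onto projective modules split. -/
theorem equiv_ker_prod [Module.Projective R P] (f : X →ₗ[R] P) (hf : Function.Surjective f) :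
    Nonempty (X ≃ₗ[R] LinearMap.ker f × P) := by
  obtain ⟨g, hg⟩ := Module.projective_lifting_property f LinearMap.id hf
  have hg' : ∀ y, f (g y) = y := LinearMap.congr_fun hg
  refine ⟨LinearEquiv.ofLinearMap
    (((LinearMap.id - g ∘ₗ f).codRestrict (LinearMap.ker f) fun x => by simp [hg']).prod f)
    ((LinearMap.ker f).subtype.coprod g) ?_ ?_⟩
  · refine LinearMap.ext fun ⟨⟨x, hx⟩, y⟩ => ?_
    rw [LinearMap.mem_ker] at hx
    refine Prod.ext (Subtype.ext ?_) ?_ <;> simp [hg', hx]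
  · ext x
    simp

theorem equiv_prod_quotient (N : Submodule R X) [Module.Projective R (X ⧸ N)] :
    Nonempty (X ≃ₗ[R] N × (X ⧸ N)) := by
  obtain ⟨e⟩ := equiv_ker_prod N.mkQ N.mkQ_surjective
  exact ⟨e.trans ((LinearEquiv.ofEq _ _ N.ker_mkQ).prodCongr (LinearEquiv.refl R _))⟩

/-- Finitely supported functions with values in a product. -/
def finsuppProdEquiv (R P C ι : Type*) [Ring R] [AddCommGroup P] [Module R P] [AddCommGroup C]
    [Module R C] : (ι →₀ P × C) ≃ₗ[R] (ι →₀ P) × (ι →₀ C) :=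
  LinearEquiv.ofLinearMap
    ((Finsupp.mapRange.linearMap (LinearMap.fst R P C)).prod
      (Finsupp.mapRange.linearMap (LinearMap.snd R P C)))
    ((Finsupp.mapRange.linearMap (LinearMap.inl R P C)).coprod
      (Finsupp.mapRange.linearMap (LinearMap.inr R P C)))
    (by ext <;> simp) (by ext <;> simp)

/-- A copy of `P` is absorbed by `ℕ →₀ P`. -/
def finsuppAbsorb (R P : Type*) [Ring R] [AddCommGroup P] [Module R P] :
    (P × (ℕ →₀ P)) ≃ₗ[R] (ℕ →₀ P) :=
  ((Finsupp.uniqueLinearEquiv R P ()).symm.prodCongr (LinearEquiv.refl R _)).trans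
    ((Finsupp.sumFinsuppLEquivProdFinsupp R).symm.trans
      (Finsupp.domLCongr ((Equiv.sumComm Unit ℕ).trans Equiv.natSumPUnitEquivNat)))

/-- Infinitely generated free modules absorb finitely generated projective modules. -/
theorem free_prod_of_infinite [Module.Finite R P] [Module.Projective R P] {ι : Type*} [Infinite ι]
    (b : Module.Basis ι R F) : Module.Free R (P × F) := by
  classical
  obtain ⟨m, f, hf⟩ := Module.Finite.exists_fin' R P
  -- At least one generator is needed for `ℕ × Fin (m + 1)` to be infinite, so that `ℕ →₀ R`
  -- regroups as a countable sum of copies of `ker f × P`.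
  obtain ⟨m, f, hf⟩ : ∃ (m : ℕ) (f : (Fin (m + 1) → R) →ₗ[R] P), Function.Surjective f :=
    ⟨m, f ∘ₗ LinearMap.funLeft R R Fin.castSucc,
      hf.comp (LinearMap.funLeft_surjective_of_injective R R _ (Fin.castSucc_injective m))⟩
  obtain ⟨e⟩ := equiv_ker_prod f hf
  let j : ℕ ↪ ι := Infinite.natEmbedding ι
  let _ : Denumerable (ℕ × Fin (m + 1)) := Denumerable.ofEncodableOfInfinite _
  let T := {i // i ∉ Set.range j}
  let E := (ℕ →₀ LinearMap.ker f) × (ℕ →₀ P)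
  let e1 : (ℕ →₀ R) ≃ₗ[R] E :=
    (Finsupp.domLCongr (Denumerable.equiv₂ ℕ (ℕ × Fin (m + 1)))).trans
      ((Finsupp.curryLinearEquiv R).trans
        ((Finsupp.mapRange.linearEquiv ((Finsupp.linearEquivFunOnFinite R R _).trans e)).trans
          (finsuppProdEquiv R _ _ ℕ)))
  let σ : ι ≃ ℕ ⊕ T := (Equiv.sumCompl (· ∈ Set.range j)).symm.trans
    ((Equiv.ofInjective j j.injective).symm.sumCongr (Equiv.refl _))
  let e2 : F ≃ₗ[R] E × (T →₀ R) := b.repr.trans ((Finsupp.domLCongr σ).trans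
    ((Finsupp.sumFinsuppLEquivProdFinsupp R).trans (e1.prodCongr (LinearEquiv.refl R _))))
  let e3 : (P × E) ≃ₗ[R] E :=
    ((LinearEquiv.refl R P).prodCongr (LinearEquiv.prodComm R _ _)).trans
      ((LinearEquiv.prodAssoc R P _ _).symm.trans
        (((finsuppAbsorb R P).prodCongr (LinearEquiv.refl R _)).trans
          (LinearEquiv.prodComm R _ _)))
  have : Module.Free R F := Module.Free.of_basis b
  exact Module.Free.of_equiv (((LinearEquiv.refl R P).prodCongr e2).trans
    ((LinearEquiv.prodAssoc R P E _).symm.trans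
      ((e3.prodCongr (LinearEquiv.refl R _)).trans e2.symm))).symm

end Swindle

/-! ### Bases along chains of submodules -/

section Extension

variable {R : Type*} [Ring R] {X Y Z : Type*} [AddCommGroup X] [Module R X] [AddCommGroup Y]
  [Module R Y] [AddCommGroup Z] [Module R Z]

/-- Lifts of a linearly independent family of the quotient by the span of a linearly independent
set extend that set. -/
theorem linearIndepOn_union_range {B : Set X} (hB : LinearIndepOn R id B) {ι : Type*} (v : ι → X)
    (hv : LinearIndependent R ((Submodule.span R B).mkQ ∘ v)) :
    LinearIndepOn R id (B ∪ Set.range v) := by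
  have h1 : LinearIndependent R (fun b : B => (⟨b, Submodule.subset_span b.2⟩ :
      Submodule.span R B)) :=
    LinearIndependent.of_comp (Submodule.span R B).subtype hB
  have h2 := h1.sumElim_of_quotient v hv
  have h3 := h2.linearIndepOn_id
  rw [Set.Sum.elim_range] at h3
  simpa using h3

/-- A chain of submodules starting at zero, with free quotients, has a free union. -/
theorem exists_basis_of_chain (N : ℕ → Submodule R X) (h0 : N 0 = ⊥) {ι : ℕ → Type*}
    (v : ∀ i, ι i → X) (hv : ∀ i, LinearIndependent R ((N i).mkQ ∘ v i))
    (hN : ∀ i, N (i + 1) = N i ⊔ Submodule.span R (Set.range (v i))) :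
    LinearIndepOn R id (⋃ i, Set.range (v i)) ∧
      Submodule.span R (⋃ i, Set.range (v i)) = ⨆ i, N i := by
  have key : ∀ n, LinearIndepOn R id (⋃ i ∈ Set.Iio n, Set.range (v i)) ∧
      Submodule.span R (⋃ i ∈ Set.Iio n, Set.range (v i)) = N n := fun n => by
    induction n with
    | zero =>
      simp [h0]
    | succ n ih =>
      have hset : (⋃ i ∈ Set.Iio (n + 1), Set.range (v i)) =
          (⋃ i ∈ Set.Iio n, Set.range (v i)) ∪ Set.range (v n) := by
        ext x
        simp only [Set.mem_iUnion, Set.mem_Iio, Set.mem_union, Nat.lt_succ_iff_lt_or_eq]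
        aesop
      rw [hset]
      refine ⟨linearIndepOn_union_range ih.1 _ ?_, ?_⟩
      · rw [ih.2]; exact hv n
      · rw [Submodule.span_union, ih.2, hN]
  have hunion : (⋃ i, Set.range (v i)) = ⋃ n, ⋃ i ∈ Set.Iio n, Set.range (v i) := by
    ext x
    simp only [Set.mem_iUnion, Set.mem_Iio]
    exact ⟨fun ⟨i, hi⟩ => ⟨i + 1, i, Nat.lt_succ_self i, hi⟩, fun ⟨_, i, _, hi⟩ => ⟨i, hi⟩⟩
  rw [hunion]
  refine ⟨linearIndepOn_iUnion_of_directed (Monotone.directed_le fun m n hmn =>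
    Set.biUnion_subset_biUnion_left (Set.Iio_subset_Iio hmn)) fun n => (key n).1, ?_⟩
  rw [Submodule.span_iUnion]
  exact iSup_congr fun n => (key n).2

end Extension

/-! ### Semilocality of the opposite ring -/

section Opposite

variable {A : Type*} [Ring A]

open MulOpposite

theorem exists_mul_one_sub_of_mem_jacobson {y : A} (hy : y ∈ Ring.jacobson A) :
    ∃ u, u * (1 - y) = 1 := by
  by_contra! h
  have hne : Ideal.span {1 - y} ≠ ⊤ := fun htop => by
    have h1 : (1 : A) ∈ Ideal.span {1 - y} := htop ▸ Submodule.mem_top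
    obtain ⟨u, hu⟩ := Ideal.mem_span_singleton'.1 h1
    exact h u hu
  obtain ⟨m, hm, hle⟩ := Ideal.exists_le_maximal _ hne
  refine hm.ne_top (m.eq_top_iff_one.2 ?_)
  simpa using m.add_mem (hle (Ideal.subset_span rfl)) (Ring.jacobson_le_of_isMaximal m hy)

/-- A left inverse `u` of `1 - y` equals `1 + u y`, so it has a left inverse too, necessarily `1 -
y`. -/
theorem isUnit_one_sub_of_mem_jacobson {y : A} (hy : y ∈ Ring.jacobson A) : IsUnit (1 - y) := by
  obtain ⟨u, hu⟩ := exists_mul_one_sub_of_mem_jacobson hy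
  obtain ⟨w, hw⟩ := exists_mul_one_sub_of_mem_jacobson
    ((Ring.jacobson A).neg_mem ((Ring.jacobson A).mul_mem_left u hy))
  have h1 : 1 - -(u * y) = u := by
    rw [mul_sub, mul_one, sub_eq_iff_eq_add] at hu
    rw [sub_neg_eq_add, ← hu]
  rw [h1] at hw
  have h2 : w = 1 - y := by
    calc w = w * (u * (1 - y)) := by rw [hu, mul_one]
      _ = 1 - y := by rw [← mul_assoc, hw, one_mul]
  exact ⟨⟨1 - y, u, h2 ▸ hw, hu⟩, rfl⟩

theorem op_mem_jacobson {x : A} (hx : x ∈ Ring.jacobson A) : op x ∈ Ring.jacobson Aᵐᵒᵖ := by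
  rw [Ring.jacobson_eq_sInf_isMaximal, Ideal.mem_sInf]
  intro m hm
  have hm : m.IsMaximal := hm
  by_contra hxm
  obtain ⟨r, z, hz, hrz⟩ := hm.exists_inv hxm
  have h1 : z = op (1 - x * unop r) := unop_injective (by
    rw [eq_sub_of_add_eq' hrz]; simp)
  have h2 : x * unop r ∈ Ring.jacobson A := (Ring.jacobson A).mul_mem_right _ hx
  refine hm.ne_top (Ideal.eq_top_of_isUnit_mem _ hz ?_)
  rw [h1]
  exact (isUnit_one_sub_of_mem_jacobson h2).op

/-- The opposite of `Aᵐᵒᵖ ⧸ J(Aᵐᵒᵖ)` is a quotient of `A ⧸ J(A)`, and semisimplicity of rings is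
left-right symmetric. -/
theorem IsSemilocal.semisimple_op (hA : IsSemilocal A) :
    IsSemisimpleModule Aᵐᵒᵖ (Aᵐᵒᵖ ⧸ Ring.jacobson Aᵐᵒᵖ) := by
  have : IsSemisimpleRing (A ⧸ Ring.jacobson A) := hA
  let f : A ⧸ Ring.jacobson A →+* (Aᵐᵒᵖ ⧸ Ring.jacobson Aᵐᵒᵖ)ᵐᵒᵖ :=
    Ideal.Quotient.lift _ ((RingHom.op (Ideal.Quotient.mk (Ring.jacobson Aᵐᵒᵖ))).comp
      (RingEquiv.opOp A).toRingHom) fun a ha => unop_injective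
        (Ideal.Quotient.eq_zero_iff_mem.2 (op_mem_jacobson ha))
  have hf : Function.Surjective f := fun y => by
    obtain ⟨x, hx⟩ := Ideal.Quotient.mk_surjective (unop y)
    exact ⟨Ideal.Quotient.mk _ (unop x), unop_injective hx⟩
  have h1 := f.isSemisimpleRing_of_surjective hf
  rw [isSemisimpleRing_mulOpposite_iff] at h1
  let g : (Aᵐᵒᵖ ⧸ Ring.jacobson Aᵐᵒᵖ) →ₛₗ[Ideal.Quotient.mk (Ring.jacobson Aᵐᵒᵖ)]
      (Aᵐᵒᵖ ⧸ Ring.jacobson Aᵐᵒᵖ) := ⟨AddHom.id _, fun _ _ => rfl⟩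
  have : RingHomSurjective (Ideal.Quotient.mk (Ring.jacobson Aᵐᵒᵖ)) :=
    ⟨Ideal.Quotient.mk_surjective⟩
  exact (g.isSemisimpleModule_iff_of_bijective Function.bijective_id).2 h1

end Opposite

/-! ### Finitely generated Hopf modules -/

section FinitelyGenerated

variable {k H A : Type*} [Field k] [Ring H] [HopfAlgebra k H] [Ring A] [Algebra k A] [Module H A]
  [IsScalarTower k H A] [IsModuleAlgebra k H A]
  {X : Type*} [AddCommGroup X] [Module Aᵐᵒᵖ X] [Module H X]

theorem nonempty_basis_of_mult_le (hR : IsSemisimpleModule Aᵐᵒᵖ (Aᵐᵒᵖ ⧸ Ring.jacobson Aᵐᵒᵖ))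
    (hA : IsHSimple H A) [HopfCompat k H A X] [Module.Finite Aᵐᵒᵖ X] {t : Type*}
    {I : t → Ideal Aᵐᵒᵖ} (hI : IsCompleteFamily I) (n : ℕ)
    (hle : ∀ j, mult (I j) X ≤ n * mult (I j) Aᵐᵒᵖ) (K : Ideal Aᵐᵒᵖ) [K.IsMaximal]
    (hK : mult K X = n * mult K Aᵐᵒᵖ) : Nonempty (Module.Basis (Fin n) Aᵐᵒᵖ X) := by
  obtain ⟨f, hf⟩ := exists_generators hR hI n hle
  have hspan : Submodule.span Aᵐᵒᵖ (Set.range (f ∘ Pi.basisFun Aᵐᵒᵖ (Fin n))) = ⊤ := by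
    rw [Set.range_comp, ← Submodule.map_span, (Pi.basisFun Aᵐᵒᵖ (Fin n)).span_eq,
      Submodule.map_top, LinearMap.range_eq_top.2 hf]
  have := finite_dual (X := X) (S := Aᵐᵒᵖ ⧸ K) hR
  have := finite_dual (X := Aᵐᵒᵖ) (S := Aᵐᵒᵖ ⧸ K) hR
  exact ⟨Module.Basis.mk (linearIndependent_of_mult_eq (k := k) hA K _ hspan hK) hspan.ge⟩

/-- At a simple module maximizing `mult X / mult A`, let `d = mult A` and `N = mult X`. Then `N`
elements generate `X^d`, with equality of multiplicities at that module. -/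
theorem exists_basis_pow [Nontrivial A]
    (hR : IsSemisimpleModule Aᵐᵒᵖ (Aᵐᵒᵖ ⧸ Ring.jacobson Aᵐᵒᵖ))
    (hA : IsHSimple H A) [HopfCompat k H A X] [Module.Finite Aᵐᵒᵖ X] :
    ∃ d N : ℕ, 0 < d ∧ Nonempty (Module.Basis (Fin N) Aᵐᵒᵖ (Fin d → X)) := by
  obtain ⟨t, I, hI⟩ := exists_completeFamily hR
  have := hI.isMaximal
  have hfin := fun j => finite_dual (X := X) (S := Aᵐᵒᵖ ⧸ I j) hR
  have hpos := fun j => mult_self_pos hR (I j)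
  have : Nonempty (Fin t) := by
    obtain ⟨K, hK⟩ := Ideal.exists_maximal Aᵐᵒᵖ
    obtain ⟨j, -⟩ := hI.complete K hK
    exact ⟨j⟩
  obtain ⟨j₀, hj₀⟩ := Finite.exists_max fun j => (mult (I j) X : ℚ) / mult (I j) Aᵐᵒᵖ
  refine ⟨mult (I j₀) Aᵐᵒᵖ, mult (I j₀) X, hpos j₀,
    nonempty_basis_of_mult_le (k := k) hR hA hI _ (fun j => ?_) (I j₀) ?_⟩
  · have h1 := hj₀ j
    rw [div_le_div_iff₀ (by exact_mod_cast hpos j) (by exact_mod_cast hpos j₀)] at h1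
    rw [mult_pi, Fintype.card_fin, mul_comm]
    exact_mod_cast h1
  · rw [mult_pi, Fintype.card_fin, mul_comm]

theorem projective_of_finite [Nontrivial A]
    (hR : IsSemisimpleModule Aᵐᵒᵖ (Aᵐᵒᵖ ⧸ Ring.jacobson Aᵐᵒᵖ))
    (hA : IsHSimple H A) [HopfCompat k H A X] [Module.Finite Aᵐᵒᵖ X] :
    Module.Projective Aᵐᵒᵖ X := by
  obtain ⟨d, N, hd, ⟨b⟩⟩ := exists_basis_pow (k := k) (X := X) hR hA
  have := Module.Projective.of_basis b
  have : Nonempty (Fin d) := ⟨⟨0, hd⟩⟩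
  exact Module.Projective.of_split (LinearMap.pi fun _ : Fin d => LinearMap.id)
    (LinearMap.proj ⟨0, hd⟩) rfl

/-- A finitely generated Hopf module is free if one of its multiplicities is divisible by the
corresponding multiplicity of the algebra. -/
theorem nonempty_basis_of_mult_eq [Nontrivial A]
    (hR : IsSemisimpleModule Aᵐᵒᵖ (Aᵐᵒᵖ ⧸ Ring.jacobson Aᵐᵒᵖ))
    (hA : IsHSimple H A) [HopfCompat k H A X] [Module.Finite Aᵐᵒᵖ X] (K : Ideal Aᵐᵒᵖ)
    [K.IsMaximal] {n : ℕ} (hK : mult K X = n * mult K Aᵐᵒᵖ) :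
    Nonempty (Module.Basis (Fin n) Aᵐᵒᵖ X) := by
  obtain ⟨t, I, hI⟩ := exists_completeFamily hR
  have := hI.isMaximal
  obtain ⟨d, N, hd, ⟨b⟩⟩ := exists_basis_pow (k := k) (X := X) hR hA
  -- Freeness of `X^d` makes the multiplicities of `X` proportional to those of `A`; the ratio `N /
  -- d` is then read off at `K`.
  have hmul : ∀ (L : Ideal Aᵐᵒᵖ) [L.IsMaximal], d * mult L X = N * mult L Aᵐᵒᵖ := fun L _ => by
    have := finite_dual (X := X) (S := Aᵐᵒᵖ ⧸ L) hR
    have := finite_dual (X := Aᵐᵒᵖ) (S := Aᵐᵒᵖ ⧸ L) hR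
    have h := mult_congr L b.equivFun
    rwa [mult_pi, mult_pi, Fintype.card_fin, Fintype.card_fin] at h
  have hN : N = d * n := by
    have h := hmul K
    rw [hK, ← mul_assoc] at h
    exact (Nat.eq_of_mul_eq_mul_right (mult_self_pos hR K) h).symm
  refine nonempty_basis_of_mult_le (k := k) hR hA hI n (fun j => ?_) K hK
  have h := hmul (I j)
  rw [hN, mul_assoc] at h
  exact (Nat.eq_of_mul_eq_mul_left hd h).le

end FinitelyGenerated

/-! ### Stable submodules and locally finite modules -/

section Stable

variable {H R X : Type*} [Ring H] [Ring R] [AddCommGroup X] [Module R X] [Module H X]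

/-- Stability of a submodule under the action of `H`. -/
def IsStable (H : Type*) {R X : Type*} [Ring H] [Ring R] [AddCommGroup X] [Module R X] [Module H X]
    (N : Submodule R X) : Prop :=
  ∀ (h : H) (x : X), x ∈ N → h • x ∈ N

/-- The action of `H` on a stable submodule. -/
abbrev IsStable.module {N : Submodule R X} (hN : IsStable H N) : Module H N where
  smul h x := ⟨h • (x : X), hN h x x.2⟩
  one_smul x := Subtype.ext (one_smul H (x : X))
  mul_smul h h' x := Subtype.ext (mul_smul h h' (x : X))
  smul_zero h := Subtype.ext (smul_zero h)
  smul_add h x y := Subtype.ext (smul_add h (x : X) y)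
  add_smul h h' x := Subtype.ext (add_smul h h' (x : X))
  zero_smul x := Subtype.ext (zero_smul H (x : X))

/-- The action of `H` on the quotient by a stable submodule. -/
abbrev IsStable.moduleQuotient {N : Submodule R X} (hN : IsStable H N) : Module H (X ⧸ N) where
  smul h := QuotientAddGroup.map N.toAddSubgroup N.toAddSubgroup
    (DistribSMul.toAddMonoidHom X h) (hN h)
  one_smul x := by
    obtain ⟨x, rfl⟩ := N.mkQ_surjective x
    exact congrArg N.mkQ (one_smul H x)
  mul_smul h h' x := by
    obtain ⟨x, rfl⟩ := N.mkQ_surjective x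
    exact congrArg N.mkQ (mul_smul h h' x)
  smul_zero h := congrArg N.mkQ (smul_zero h)
  smul_add h x y := by
    obtain ⟨x, rfl⟩ := N.mkQ_surjective x
    obtain ⟨y, rfl⟩ := N.mkQ_surjective y
    exact congrArg N.mkQ (smul_add h x y)
  add_smul h h' x := by
    obtain ⟨x, rfl⟩ := N.mkQ_surjective x
    exact congrArg N.mkQ (add_smul h h' x)
  zero_smul x := by
    obtain ⟨x, rfl⟩ := N.mkQ_surjective x
    exact congrArg N.mkQ (zero_smul H x)

theorem IsStable.sup {N N' : Submodule R X} (hN : IsStable H N) (hN' : IsStable H N') :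
    IsStable H (N ⊔ N') := fun h x hx => by
  obtain ⟨y, hy, z, hz, rfl⟩ := Submodule.mem_sup.1 hx
  rw [smul_add]
  exact Submodule.add_mem_sup (hN h y hy) (hN' h z hz)

theorem IsStable.bot : IsStable H (⊥ : Submodule R X) := fun h x hx => by
  rw [Submodule.mem_bot] at hx ⊢
  rw [hx, smul_zero]

theorem IsStable.iSup_of_directed {ι : Type*} [Nonempty ι] {N : ι → Submodule R X}
    (hd : Directed (· ≤ ·) N) (hN : ∀ i, IsStable H (N i)) : IsStable H (⨆ i, N i) :=
  fun h x hx => by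
    rw [Submodule.mem_iSup_of_directed _ hd] at hx ⊢
    exact hx.imp fun i hi => hN i h x hi

end Stable

section LocallyFinite

variable {H A X : Type*} [Ring H] [Ring A] [AddCommGroup X] [Module Aᵐᵒᵖ X] [Module H X]

theorem IsLocallyFinite.quotient (hX : IsLocallyFinite H A X) {N : Submodule Aᵐᵒᵖ X}
    (hN : IsStable H N) : letI := hN.moduleQuotient; IsLocallyFinite H A (X ⧸ N) := by
  let _ := hN.moduleQuotient
  intro x
  obtain ⟨x, rfl⟩ := N.mkQ_surjective x
  obtain ⟨L, hL, hfg, hx⟩ := hX x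
  refine ⟨L.map N.mkQ, ?_, hfg.map _, Submodule.mem_map_of_mem hx⟩
  rintro h _ ⟨y, hy, rfl⟩
  exact ⟨h • y, hL h y hy, rfl⟩

/-- A locally finite Hopf module which is not finitely generated contains a strictly increasing
sequence of finitely generated subobjects with the same multiplicity modulo a given number. -/
theorem exists_strictMono_stable (hX : IsLocallyFinite H A X) (hfg : ¬ Module.Finite Aᵐᵒᵖ X)
    (ρ : Submodule Aᵐᵒᵖ X → ℕ) {d : ℕ} (hd : 0 < d) :
    ∃ N : ℕ → Submodule Aᵐᵒᵖ X, StrictMono N ∧ (∀ i, IsStable H (N i)) ∧ (∀ i, (N i).FG) ∧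
      ∀ i, ρ (N i) % d = ρ (N (i + 1)) % d := by
  -- Some residue class is cofinal: otherwise choose for each `c` a subobject contained in none of
  -- residue `c`; the sum of these finitely many has some residue, a contradiction.
  obtain ⟨c, hc⟩ : ∃ c : Fin d, ∀ N : Submodule Aᵐᵒᵖ X, IsStable H N → N.FG →
      ∃ N', N ≤ N' ∧ IsStable H N' ∧ N'.FG ∧ ρ N' % d = c := by
    by_contra! hcon
    choose N hN hNfg hNc using hcon
    have hS : IsStable H (⨆ c, N c) ∧ (⨆ c, N c).FG := by
      refine ⟨?_, Submodule.fg_iSup N hNfg⟩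
      intro h x hx
      induction hx using Submodule.iSup_induction' with
      | mem i x hx => exact Submodule.mem_iSup_of_mem i (hN i h x hx)
      | zero => rw [smul_zero]; exact zero_mem _
      | add x y _ _ hx hy => rw [smul_add]; exact add_mem hx hy
    exact hNc ⟨_, Nat.mod_lt (ρ (⨆ c, N c)) hd⟩ _ (le_iSup N _) hS.1 hS.2 rfl
  let T := {N : Submodule Aᵐᵒᵖ X // IsStable H N ∧ N.FG ∧ ρ N % d = c}
  have : Nonempty T := by
    obtain ⟨N, -, hN⟩ := hc ⊥ IsStable.bot Submodule.fg_bot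
    exact ⟨⟨N, hN⟩⟩
  have : NoMaxOrder T := ⟨fun ⟨N, hN, hNfg, hNc⟩ => by
    have hne : N ≠ ⊤ := fun h => hfg ⟨h ▸ hNfg⟩
    obtain ⟨x, -, hx⟩ := SetLike.exists_of_lt hne.lt_top
    obtain ⟨L, hL, hLfg, hxL⟩ := hX x
    obtain ⟨N', hle, hN'⟩ := hc (N ⊔ L) (hN.sup hL) (hNfg.sup hLfg)
    exact ⟨⟨N', hN'⟩, lt_of_le_of_ne (le_sup_left.trans hle) fun h => hx (by
      rw [show N = N' from congrArg Subtype.val h]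
      exact hle (Submodule.mem_sup_right hxL))⟩⟩
  obtain ⟨f, hf⟩ := Nat.exists_strictMono T
  exact ⟨fun i => f i, fun i j hij => hf hij, fun i => (f i).2.1, fun i => (f i).2.2.1,
    fun i => (f i).2.2.2.trans (f (i + 1)).2.2.2.symm⟩

end LocallyFinite

/-! ### Locally finite Hopf modules of infinite type -/

section Infinite

variable {k H A : Type*} [Field k] [Ring H] [HopfAlgebra k H] [Ring A] [Algebra k A] [Module H A]
  {X : Type*} [AddCommGroup X] [Module Aᵐᵒᵖ X] [Module H X]

theorem IsStable.compat {N : Submodule Aᵐᵒᵖ X} (hN : IsStable H N) [HopfCompat k H A X] :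
    letI := hN.module; HopfCompat k H A N :=
  letI := hN.module
  .of_injective N.subtype N.subtype_injective fun _ _ => rfl

theorem IsStable.compat_quotient {N : Submodule Aᵐᵒᵖ X} (hN : IsStable H N)
    [HopfCompat k H A X] : letI := hN.moduleQuotient; HopfCompat k H A (X ⧸ N) :=
  letI := hN.moduleQuotient
  .of_surjective N.mkQ N.mkQ_surjective fun _ _ => rfl

variable [IsScalarTower k H A] [IsModuleAlgebra k H A]

/-- A finitely generated stable submodule with suitable multiplicity over a smaller one is free
relative to it. -/
theorem exists_relative_basis [Nontrivial A]
    (hR : IsSemisimpleModule Aᵐᵒᵖ (Aᵐᵒᵖ ⧸ Ring.jacobson Aᵐᵒᵖ))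
    (hA : IsHSimple H A) [HopfCompat k H A X] (K : Ideal Aᵐᵒᵖ) [K.IsMaximal]
    {N N' : Submodule Aᵐᵒᵖ X} (hN : IsStable H N) (hN' : IsStable H N') (hfg : N.FG)
    (hfg' : N'.FG) (hlt : N < N')
    (hmod : mult K N % mult K Aᵐᵒᵖ = mult K N' % mult K Aᵐᵒᵖ) :
    ∃ (n : ℕ) (v : Fin (n + 1) → X), LinearIndependent Aᵐᵒᵖ (N.mkQ ∘ v) ∧
      N' = N ⊔ Submodule.span Aᵐᵒᵖ (Set.range v) := by
  let _ := hN.moduleQuotient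
  have : HopfCompat k H A (X ⧸ N) := hN.compat_quotient
  let D := N'.map N.mkQ
  have hD : IsStable H D := by
    rintro h _ ⟨y, hy, rfl⟩
    exact ⟨h • y, hN' h y hy, rfl⟩
  let _ := hD.module
  have : HopfCompat k H A D := hD.compat
  have : Module.Finite Aᵐᵒᵖ D := Module.Finite.iff_fg.2 (hfg'.map _)
  have : Module.Finite Aᵐᵒᵖ N := Module.Finite.iff_fg.2 hfg
  have := projective_of_finite (k := k) (X := D) hR hA
  have hfinN := finite_dual (X := N) (S := Aᵐᵒᵖ ⧸ K) hR
  have hfinD := finite_dual (X := D) (S := Aᵐᵒᵖ ⧸ K) hR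
  let f : N' →ₗ[Aᵐᵒᵖ] D := N.mkQ.submoduleMap N'
  have hf : Function.Surjective f := N.mkQ.submoduleMap_surjective N'
  obtain ⟨e⟩ := equiv_ker_prod f hf
  have hker : Nonempty (LinearMap.ker f ≃ₗ[Aᵐᵒᵖ] N) := by
    have h1 : LinearMap.ker f = N.comap N'.subtype := by
      ext x
      rw [LinearMap.mem_ker, Submodule.mem_comap, ← Submodule.Quotient.mk_eq_zero, Subtype.ext_iff]
      rfl
    exact ⟨(LinearEquiv.ofEq _ _ h1).trans (Submodule.comapSubtypeEquivOfLe hlt.le)⟩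
  obtain ⟨e'⟩ := hker
  have hadd : mult K N' = mult K N + mult K D := by
    rw [mult_congr K (e.trans (e'.prodCongr (LinearEquiv.refl _ _))), mult_prod]
  obtain ⟨n, hn⟩ : mult K Aᵐᵒᵖ ∣ mult K D := by
    have := (Nat.modEq_iff_dvd' (by omega)).1 (show mult K N ≡ mult K N' [MOD _] from hmod)
    rwa [hadd, Nat.add_sub_cancel_left] at this
  obtain ⟨b⟩ := nonempty_basis_of_mult_eq (k := k) (X := D) hR hA K (n := n) (by rw [hn, mul_comm])
  -- Rank zero would give `N' ≤ N`. A positive rank at each stage later makes the union of the bases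
  -- infinite.
  obtain _ | n := n
  · exfalso
    have hsub : Subsingleton D := b.repr.toEquiv.subsingleton
    refine hlt.not_ge fun x hx => ?_
    have h0 : (⟨N.mkQ x, Submodule.mem_map_of_mem hx⟩ : D) = 0 := Subsingleton.elim _ _
    rw [← Submodule.Quotient.mk_eq_zero]
    exact congrArg Subtype.val h0
  choose v hv using fun i => (b i).2
  have hcomp : N.mkQ ∘ v = D.subtype ∘ b := funext fun i => (hv i).2
  refine ⟨n, v, ?_, ?_⟩
  · rw [hcomp]
    exact b.linearIndependent.map' D.subtype D.ker_subtype
  · have h1 : (Submodule.span Aᵐᵒᵖ (Set.range v)).map N.mkQ = D := by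
      rw [Submodule.map_span, ← Set.range_comp, hcomp, Set.range_comp, ← Submodule.map_span,
        b.span_eq, Submodule.map_top, Submodule.range_subtype]
    have h2 := congrArg (Submodule.comap N.mkQ) h1
    rw [Submodule.comap_map_mkQ, Submodule.comap_map_mkQ, sup_eq_right.2 hlt.le] at h2
    exact h2.symm

/-- A locally finite Hopf module which is not finitely generated contains a nonzero free stable
submodule. -/
theorem exists_free_stable [Nontrivial A]
    (hR : IsSemisimpleModule Aᵐᵒᵖ (Aᵐᵒᵖ ⧸ Ring.jacobson Aᵐᵒᵖ))
    (hA : IsHSimple H A) [HopfCompat k H A X] (hX : IsLocallyFinite H A X)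
    (hfg : ¬ Module.Finite Aᵐᵒᵖ X) :
    ∃ U : Submodule Aᵐᵒᵖ X, IsStable H U ∧ U ≠ ⊥ ∧ Module.Free Aᵐᵒᵖ U := by
  obtain ⟨K, hK⟩ := Ideal.exists_maximal Aᵐᵒᵖ
  obtain ⟨N, hN, hst, hNfg, hmod⟩ := exists_strictMono_stable hX hfg (fun N => mult K N)
    (mult_self_pos hR K)
  choose n v hv hsup using fun i => exists_relative_basis (k := k) hR hA K (hst i) (hst (i + 1))
    (hNfg i) (hNfg (i + 1)) (hN (Nat.lt_succ_self i)) (hmod i)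
  let U := ⨆ i, N i
  have hU : IsStable H U := IsStable.iSup_of_directed hN.monotone.directed_le hst
  refine ⟨U, hU, ?_, ?_⟩
  · exact ((bot_le.trans_lt (hN Nat.zero_lt_one)).trans_le (le_iSup N 1)).ne'
  -- the quotient of `U` by `N 0` is free of infinite rank
  let π := (N 0).mkQ
  obtain ⟨hli, hspan⟩ := exists_basis_of_chain (fun i => (N i).map π)
    (by simp [π]) (fun i => π ∘ v i)
    (fun i => by
      have hle : N 0 ≤ N i := hN.monotone (Nat.zero_le i)
      let g : ((X ⧸ N 0) ⧸ (N i).map π) →ₗ[Aᵐᵒᵖ] X ⧸ N i :=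
        Submodule.liftQ _ (Submodule.factor hle) (by
          rintro _ ⟨y, hy, rfl⟩
          exact (Submodule.Quotient.mk_eq_zero _).2 hy)
      exact LinearIndependent.of_comp g (hv i))
    (fun i => by
      rw [hsup i, Submodule.map_sup, Submodule.map_span, Set.range_comp])
  let D := U.map π
  let f : U →ₗ[Aᵐᵒᵖ] D := π.submoduleMap U
  have hf : Function.Surjective f := π.submoduleMap_surjective U
  let B : Set (X ⧸ N 0) := ⋃ i, Set.range (π ∘ v i)
  have hBD : Submodule.span Aᵐᵒᵖ B = D := by rw [hspan]; exact (Submodule.map_iSup π N).symm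
  let b : Module.Basis B Aᵐᵒᵖ D :=
    (Module.Basis.span hli).map (LinearEquiv.ofEq _ _ (by
      rw [← hBD]; exact congrArg _ Subtype.range_coe))
  -- For `i < j` the vector `v i 0` lies in `N j`, while `v j 0` does not.
  have hinf : Infinite B := by
    refine Infinite.of_injective
      (fun i : ℕ => (⟨π (v i 0), Set.mem_iUnion.2 ⟨i, 0, rfl⟩⟩ : B)) ?_
    refine Function.Injective.of_lt_imp_ne fun i j hij heq => (hv j).ne_zero 0 ?_
    have h1 : v i 0 ∈ N j := hN.monotone (Nat.succ_le_of_lt hij) (by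
      rw [hsup]
      exact Submodule.mem_sup_right (Submodule.subset_span ⟨0, rfl⟩))
    have h2 : v i 0 - v j 0 ∈ N 0 :=
      (Submodule.Quotient.eq (N 0)).1 (congrArg Subtype.val heq)
    refine (Submodule.Quotient.mk_eq_zero _).2 ?_
    simpa using (N j).sub_mem h1 (hN.monotone (Nat.zero_le j) h2)
  have : Module.Free Aᵐᵒᵖ D := Module.Free.of_basis b
  obtain ⟨e⟩ := equiv_ker_prod f hf
  have hker : LinearMap.ker f = (N 0).comap U.subtype := by
    ext x
    rw [LinearMap.mem_ker, Submodule.mem_comap, ← Submodule.Quotient.mk_eq_zero, Subtype.ext_iff]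
    rfl
  let e' : LinearMap.ker f ≃ₗ[Aᵐᵒᵖ] N 0 :=
    (LinearEquiv.ofEq _ _ hker).trans (Submodule.comapSubtypeEquivOfLe (le_iSup N 0))
  let _ := (hst 0).module
  have : HopfCompat k H A (N 0) := (hst 0).compat
  have : Module.Finite Aᵐᵒᵖ (N 0) := Module.Finite.iff_fg.2 (hNfg 0)
  have := projective_of_finite (k := k) (X := N 0) hR hA
  -- `U ≃ N 0 × D`, where the projective `N 0` is absorbed by `D`, free of infinite rank.
  have := free_prod_of_infinite (P := N 0) b
  exact Module.Free.of_equiv (e.trans (e'.prodCongr (LinearEquiv.refl _ _))).symm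

/-- A locally finite Hopf module is an extension of a finitely generated Hopf module by a free
one. -/
theorem exists_maximal_free_stable [Nontrivial A]
    (hR : IsSemisimpleModule Aᵐᵒᵖ (Aᵐᵒᵖ ⧸ Ring.jacobson Aᵐᵒᵖ))
    (hA : IsHSimple H A) [HopfCompat k H A X] (hX : IsLocallyFinite H A X) :
    ∃ B : Set X, LinearIndepOn Aᵐᵒᵖ id B ∧ IsStable H (Submodule.span Aᵐᵒᵖ B) ∧
      Module.Finite Aᵐᵒᵖ (X ⧸ Submodule.span Aᵐᵒᵖ B) := by
  -- Zorn is applied to independent sets rather than free submodules, since the union of a chain of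
  -- free submodules need not be free.
  obtain ⟨B, hB⟩ := zorn_subset {B : Set X | LinearIndepOn Aᵐᵒᵖ id B ∧
      IsStable H (Submodule.span Aᵐᵒᵖ B)} fun c hc hchain => by
    obtain rfl | hne := c.eq_empty_or_nonempty
    · exact ⟨∅, ⟨linearIndepOn_empty _ _, by
        rw [Submodule.span_empty]; exact IsStable.bot⟩, by simp⟩
    · have := hne.to_subtype
      refine ⟨⋃₀ c, ⟨linearIndepOn_sUnion_of_directed hchain.directedOn fun s hs => (hc hs).1, ?_⟩,
        fun s hs => Set.subset_sUnion_of_mem hs⟩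
      rw [Set.sUnion_eq_iUnion, Submodule.span_iUnion]
      refine IsStable.iSup_of_directed ?_ fun s => (hc s.2).2
      exact fun s s' => (hchain.directedOn.directed_val s s').imp fun u hu =>
        ⟨Submodule.span_mono hu.1, Submodule.span_mono hu.2⟩
  obtain ⟨hli, hst⟩ := hB.prop
  refine ⟨B, hli, hst, ?_⟩
  by_contra hfg
  let L := Submodule.span Aᵐᵒᵖ B
  let _ := hst.moduleQuotient
  have : HopfCompat k H A (X ⧸ L) := hst.compat_quotient
  -- Lifting a basis of `U` to `X` strictly enlarges `B`, against maximality.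
  obtain ⟨U, hU, hU0, hfree⟩ := exists_free_stable (k := k) hR hA (hX.quotient hst) hfg
  let b := Module.Free.chooseBasis Aᵐᵒᵖ U
  choose v hv using fun i => L.mkQ_surjective (b i)
  have hcomp : L.mkQ ∘ v = U.subtype ∘ b := funext hv
  have hli' : LinearIndependent Aᵐᵒᵖ (L.mkQ ∘ v) := by
    rw [hcomp]
    exact b.linearIndependent.map' U.subtype U.ker_subtype
  have hspan : Submodule.span Aᵐᵒᵖ (B ∪ Set.range v) = U.comap L.mkQ := by
    have h1 : (Submodule.span Aᵐᵒᵖ (Set.range v)).map L.mkQ = U := by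
      rw [Submodule.map_span, ← Set.range_comp, hcomp, Set.range_comp, ← Submodule.map_span,
        b.span_eq, Submodule.map_top, Submodule.range_subtype]
    have h2 := congrArg (Submodule.comap L.mkQ) h1
    rw [Submodule.comap_map_mkQ] at h2
    rw [← h2, Submodule.span_union]
  have hmem : B ∪ Set.range v ∈ {B : Set X | LinearIndepOn Aᵐᵒᵖ id B ∧
      IsStable H (Submodule.span Aᵐᵒᵖ B)} :=
    ⟨linearIndepOn_union_range hli v hli', by
      rw [hspan]
      exact fun h x hx => hU h _ hx⟩
  have hsub := hB.le_of_ge hmem Set.subset_union_left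
  have : Nontrivial U := Submodule.nontrivial_iff_ne_bot.2 hU0
  have : Nonempty (Module.Free.ChooseBasisIndex Aᵐᵒᵖ U) := b.index_nonempty
  obtain ⟨i⟩ := this
  exact hli'.ne_zero i ((Submodule.Quotient.mk_eq_zero _).2
    (Submodule.subset_span (hsub (Or.inr ⟨i, rfl⟩))))

/-- The quotient by a maximal free stable part is finitely generated, hence projective, and splits
off. If `X` is not finitely generated, the free part has infinite rank and absorbs it. -/
theorem projective_of_locallyFinite [Nontrivial A]
    (hR : IsSemisimpleModule Aᵐᵒᵖ (Aᵐᵒᵖ ⧸ Ring.jacobson Aᵐᵒᵖ))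
    (hA : IsHSimple H A) [HopfCompat k H A X] (hX : IsLocallyFinite H A X) :
    Module.Projective Aᵐᵒᵖ X ∧ (¬ Module.Finite Aᵐᵒᵖ X → Module.Free Aᵐᵒᵖ X) := by
  obtain ⟨B, hli, hst, hfin⟩ := exists_maximal_free_stable (k := k) hR hA hX
  let _ := hst.moduleQuotient
  have : HopfCompat k H A (X ⧸ Submodule.span Aᵐᵒᵖ B) := hst.compat_quotient
  have := projective_of_finite (k := k) (X := X ⧸ Submodule.span Aᵐᵒᵖ B) hR hA
  obtain ⟨e⟩ := equiv_prod_quotient (Submodule.span Aᵐᵒᵖ B)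
  let b : Module.Basis B Aᵐᵒᵖ (Submodule.span Aᵐᵒᵖ B) :=
    (Module.Basis.span hli).map (LinearEquiv.ofEq _ _ (congrArg _ Subtype.range_coe))
  have := Module.Projective.of_basis b
  refine ⟨Module.Projective.of_equiv e.symm, fun hX => ?_⟩
  have : Infinite B := by
    by_contra hB
    rw [not_infinite_iff_finite] at hB
    have := Module.Finite.of_basis b
    exact hX (Module.Finite.equiv e.symm)
  have := free_prod_of_infinite (P := X ⧸ Submodule.span Aᵐᵒᵖ B) b
  exact Module.Free.of_equiv ((e.trans (LinearEquiv.prodComm _ _ _)).symm)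

end Infinite

/-! ### Maximal two-sided ideals and reduction modulo `Q` -/

section MaximalIdeal

variable {A : Type*} [Ring A]

open MulOpposite

theorem eq_top_of_one_mem {I : TwoSidedIdeal A} (h : (1 : A) ∈ I) : I = ⊤ :=
  eq_top_iff.2 fun x _ => by simpa using I.mul_mem_left x 1 h

theorem exists_isCoatom [Nontrivial A] : ∃ Q : TwoSidedIdeal A, IsCoatom Q := by
  obtain ⟨Q, -, hQ⟩ := zorn_le_nonempty₀ {I : TwoSidedIdeal A | (1 : A) ∉ I}
    (fun c hc hchain I hI => by
      have hdir : ∀ I ∈ c, ∀ J ∈ c, ∃ L ∈ c, I ≤ L ∧ J ≤ L := hchain.directedOn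
      let U : TwoSidedIdeal A := TwoSidedIdeal.mk' {a | ∃ J ∈ c, a ∈ J} ⟨I, hI, I.zero_mem⟩
        (fun {a b} ⟨J, hJ, ha⟩ ⟨L, hL, hb⟩ => by
          obtain ⟨T, hT, h1, h2⟩ := hdir J hJ L hL
          exact ⟨T, hT, T.add_mem (h1 ha) (h2 hb)⟩)
        (fun {a} ⟨J, hJ, ha⟩ => ⟨J, hJ, J.neg_mem ha⟩)
        (fun {a b} ⟨J, hJ, hb⟩ => ⟨J, hJ, J.mul_mem_left _ _ hb⟩)
        (fun {a b} ⟨J, hJ, ha⟩ => ⟨J, hJ, J.mul_mem_right _ _ ha⟩)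
      have hU : ∀ a, a ∈ U ↔ ∃ J ∈ c, a ∈ J := fun a => TwoSidedIdeal.mem_mk' _ _ _ _ _ _ _
      refine ⟨U, fun h => ?_, fun J hJ a ha => (hU a).2 ⟨J, hJ, ha⟩⟩
      obtain ⟨J, hJ, h1⟩ := (hU 1).1 h
      exact hc hJ h1) ⊥ (by
        rw [Set.mem_ofPred_eq, TwoSidedIdeal.mem_bot]; exact one_ne_zero)
  refine ⟨Q, fun h => hQ.prop (h ▸ trivial), fun J hJ => ?_⟩
  by_contra hne
  exact hJ.not_ge (hQ.le_of_ge (fun h => hne (eq_top_of_one_mem h)) hJ.le)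

/-- A proper two-sided ideal annihilates some simple right module. -/
theorem exists_isMaximal_annihilated (Q : TwoSidedIdeal A) (hQ : Q ≠ ⊤) :
    ∃ K : Ideal Aᵐᵒᵖ, K.IsMaximal ∧ ∀ q ∈ Q, ∀ s : Aᵐᵒᵖ ⧸ K, op q • s = 0 := by
  let L : Ideal Aᵐᵒᵖ :=
    { carrier := {r | unop r ∈ Q}
      add_mem' ha hb := Q.add_mem ha hb
      zero_mem' := Q.zero_mem
      smul_mem' r x hx := Q.mul_mem_right _ _ hx }
  have hL : L ≠ ⊤ := fun h => hQ (eq_top_of_one_mem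
    (show (1 : Aᵐᵒᵖ) ∈ L from h ▸ Submodule.mem_top))
  obtain ⟨K, hK, hle⟩ := Ideal.exists_le_maximal L hL
  refine ⟨K, hK, fun q hq s => ?_⟩
  obtain ⟨r, rfl⟩ := Submodule.mkQ_surjective _ s
  exact (Submodule.Quotient.mk_eq_zero K).2 (hle (Q.mul_mem_left (unop r) q hq))

end MaximalIdeal

section Reduction

variable {A : Type*} [Ring A] {M : Type*} [AddCommGroup M] [Module Aᵐᵒᵖ M] (Q : TwoSidedIdeal A)

open MulOpposite

theorem op_mk_smul (a : A) (x : M ⧸ mulIdeal M Q) :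
    op (Ideal.Quotient.mk Q.asIdeal a) • x = op a • x := by
  obtain ⟨m, rfl⟩ := Submodule.mkQ_surjective _ x
  rfl

theorem exists_op_mk (c : (A ⧸ Q.asIdeal)ᵐᵒᵖ) :
    ∃ a : Aᵐᵒᵖ, op (Ideal.Quotient.mk Q.asIdeal (unop a)) = c := by
  obtain ⟨a, ha⟩ := Ideal.Quotient.mk_surjective (unop c)
  exact ⟨op a, unop_injective ha⟩

theorem op_mk_eq_zero_iff (a : A) : op (Ideal.Quotient.mk Q.asIdeal a) = 0 ↔ a ∈ Q := by
  rw [op_eq_zero_iff, Ideal.Quotient.eq_zero_iff_mem]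
  exact TwoSidedIdeal.mem_asIdeal

theorem span_quotient_eq_top {s : Set (M ⧸ mulIdeal M Q)} (hs : Submodule.span Aᵐᵒᵖ s = ⊤) :
    Submodule.span (A ⧸ Q.asIdeal)ᵐᵒᵖ s = ⊤ := by
  refine eq_top_iff.2 fun x _ => ?_
  have hx : x ∈ Submodule.span Aᵐᵒᵖ s := hs ▸ Submodule.mem_top
  induction hx using Submodule.span_induction with
  | mem x hx => exact Submodule.subset_span hx
  | zero => exact zero_mem _
  | add x y _ _ hx hy => exact add_mem (hx trivial) (hy trivial)
  | smul r x _ hx =>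
    have := op_mk_smul Q (unop r) x
    rw [op_unop] at this
    rw [← this]
    exact Submodule.smul_mem _ _ (hx trivial)

instance [Module.Finite Aᵐᵒᵖ M] : Module.Finite (A ⧸ Q.asIdeal)ᵐᵒᵖ (M ⧸ mulIdeal M Q) := by
  obtain ⟨s, hs⟩ := (inferInstance : Module.Finite Aᵐᵒᵖ (M ⧸ mulIdeal M Q)).fg_top
  exact ⟨⟨s, span_quotient_eq_top Q hs⟩⟩

theorem repr_mem_of_mem_mulIdeal {ι : Type*} (b : Module.Basis ι Aᵐᵒᵖ M) {x : M}
    (hx : x ∈ mulIdeal M Q) (i : ι) : unop (b.repr x i) ∈ Q := by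
  induction hx using Submodule.span_induction with
  | mem x hx =>
    obtain ⟨m, q, hq, rfl⟩ := hx
    rw [map_smul, Finsupp.smul_apply, smul_eq_mul, unop_mul, unop_op]
    exact Q.mul_mem_left _ _ hq
  | zero => rw [map_zero]; exact Q.zero_mem
  | add x y _ _ hx hy => rw [map_add, Finsupp.add_apply, unop_add]; exact Q.add_mem hx hy
  | smul r x _ hx =>
    rw [map_smul, Finsupp.smul_apply, smul_eq_mul, unop_mul]
    exact Q.mul_mem_right _ _ hx

/-- The reduction of a free module modulo a two-sided ideal is free. -/
theorem free_quotient [Module.Free Aᵐᵒᵖ M] :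
    Module.Free (A ⧸ Q.asIdeal)ᵐᵒᵖ (M ⧸ mulIdeal M Q) := by
  let b := Module.Free.chooseBasis Aᵐᵒᵖ M
  let v := (mulIdeal M Q).mkQ ∘ b
  have hspan : Submodule.span (A ⧸ Q.asIdeal)ᵐᵒᵖ (Set.range v) = ⊤ := by
    apply span_quotient_eq_top
    rw [Set.range_comp, ← Submodule.map_span, b.span_eq, Submodule.map_top, Submodule.range_mkQ]
  have hli : LinearIndependent (A ⧸ Q.asIdeal)ᵐᵒᵖ v := by
    rw [linearIndependent_iff']
    intro s g hg i hi
    choose a ha using fun i => exists_op_mk Q (g i)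
    -- The relation lifts to an element of `M Q`, whose coordinates in `b` all lie in `Q`.
    have h1 : (mulIdeal M Q).mkQ (∑ i ∈ s, a i • b i) = 0 := by
      rw [← hg, map_sum]
      refine Finset.sum_congr rfl fun j _ => ?_
      rw [← ha j, op_mk_smul, map_smul]
      rfl
    have h2 := repr_mem_of_mem_mulIdeal Q b ((Submodule.Quotient.mk_eq_zero _).1 h1) i
    rw [map_sum, Finsupp.finsetSum_apply, Finset.sum_eq_single i] at h2
    · rw [← ha i, op_mk_eq_zero_iff]
      simpa using h2
    · intro j _ hj
      simp [hj]
    · exact fun h => absurd hi h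
  exact Module.Free.of_basis (Module.Basis.mk hli hspan.ge)

/-- The multiplicity of a simple module annihilated by `Q` in terms of the rank of the reduction
modulo `Q`. -/
theorem mult_eq_of_basis_quotient (K : Ideal Aᵐᵒᵖ) [K.IsMaximal]
    (hK : ∀ q ∈ Q, ∀ s : Aᵐᵒᵖ ⧸ K, op q • s = 0)
    [Module.Finite (Module.End Aᵐᵒᵖ (Aᵐᵒᵖ ⧸ K)) (Aᵐᵒᵖ →ₗ[Aᵐᵒᵖ] Aᵐᵒᵖ ⧸ K)] {ι : Type*} [Fintype ι]
    (b : Module.Basis ι (A ⧸ Q.asIdeal)ᵐᵒᵖ (M ⧸ mulIdeal M Q)) :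
    mult K M = Fintype.card ι * mult K Aᵐᵒᵖ := by
  classical
  -- Maps into a module annihilated by `Q` vanish on `M Q`.
  have h1 : mult K (M ⧸ mulIdeal M Q) = mult K M := by
    refine (LinearEquiv.ofBijective _
      (precomp_bijective (S := Aᵐᵒᵖ ⧸ K) (mulIdeal M Q).mkQ_surjective ?_)).finrank_eq
    intro x hx g
    rw [Submodule.mkQ_apply, Submodule.Quotient.mk_eq_zero] at hx
    have hle : mulIdeal M Q ≤ LinearMap.ker g := Submodule.span_le.2 (by
      rintro _ ⟨m, q, hq, rfl⟩
      rw [SetLike.mem_coe, LinearMap.mem_ker, map_smul, hK q hq])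
    exact hle hx
  let f : (ι → Aᵐᵒᵖ) →ₗ[Aᵐᵒᵖ] M ⧸ mulIdeal M Q := Fintype.linearCombination Aᵐᵒᵖ b
  have hf : ∀ v, f v = ∑ i, op (Ideal.Quotient.mk Q.asIdeal (unop (v i))) • b i := fun v => by
    simp only [f, Fintype.linearCombination_apply, op_mk_smul, op_unop]
  have hsurj : Function.Surjective f := fun y => by
    choose a ha using fun i => exists_op_mk Q (b.repr y i)
    refine ⟨a, ?_⟩
    simp only [hf, ha, b.sum_repr]
  -- The kernel of `f` has all its coordinates in `Q`, so it too dies in the simple module.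
  have h2 : mult K (M ⧸ mulIdeal M Q) = mult K (ι → Aᵐᵒᵖ) := by
    refine (LinearEquiv.ofBijective _ (precomp_bijective (S := Aᵐᵒᵖ ⧸ K) hsurj ?_)).finrank_eq
    intro v hv g
    rw [hf] at hv
    have h0 := Fintype.linearIndependent_iff.1 b.linearIndependent _ hv
    rw [← Finset.univ_sum_single v, map_sum]
    refine Finset.sum_eq_zero fun i _ => ?_
    have hi : v i • (Pi.single i (1 : Aᵐᵒᵖ) : ι → Aᵐᵒᵖ) = Pi.single i (v i) := by
      rw [← Pi.single_smul, smul_eq_mul, mul_one]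
    rw [← hi, map_smul]
    exact hK _ ((op_mk_eq_zero_iff Q _).1 (h0 i)) _
  rw [← h1, h2, mult_pi]

end Reduction

end HopfMod

end

theorem theorem7p6 {k H A M : Type*} [Field k] [Ring H] [HopfAlgebra k H]
    [Ring A] [Nontrivial A] [Algebra k A] [Module H A] [IsScalarTower k H A]
    [HopfMod.IsModuleAlgebra k H A]
    [AddCommGroup M] [Module k M] [Module Aᵐᵒᵖ M] [IsScalarTower k Aᵐᵒᵖ M]
    [Module H M] [IsScalarTower k H M] [HopfMod.IsHopfModule k H A M]
    (hsl : HopfMod.IsSemilocal A) (hsimple : HopfMod.IsHSimple H A)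
    (hfin : HopfMod.IsLocallyFinite H A M) :
    Module.Projective Aᵐᵒᵖ M ∧
      (Module.Free Aᵐᵒᵖ M ↔
        ∃ Q : TwoSidedIdeal A, IsCoatom Q ∧
          Module.Free (A ⧸ Q.asIdeal)ᵐᵒᵖ (M ⧸ HopfMod.mulIdeal M Q)) := by
  have hR := hsl.semisimple_op
  have : HopfMod.HopfCompat k H A M := HopfMod.HopfCompat.of_isHopfModule
  obtain ⟨hproj, hfree⟩ := HopfMod.projective_of_locallyFinite (k := k) hR hsimple hfin
  refine ⟨hproj, fun _ => ?_, fun ⟨Q, hQ, hQM⟩ => ?_⟩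
  · obtain ⟨Q, hQ⟩ := HopfMod.exists_isCoatom (A := A)
    exact ⟨Q, hQ, HopfMod.free_quotient Q⟩
  -- If `M` is finitely generated, the rank of `M / M Q` gives the divisibility at a simple module
  -- killed by `Q`; otherwise `M` is free in any case.
  · by_cases hM : Module.Finite Aᵐᵒᵖ M
    · obtain ⟨K, hK, hQK⟩ := HopfMod.exists_isMaximal_annihilated Q hQ.1
      have := HopfMod.finite_dual (X := Aᵐᵒᵖ) (S := Aᵐᵒᵖ ⧸ K) hR
      let b := Module.Free.chooseBasis (A ⧸ Q.asIdeal)ᵐᵒᵖ (M ⧸ HopfMod.mulIdeal M Q)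
      obtain ⟨c⟩ := HopfMod.nonempty_basis_of_mult_eq (k := k) (X := M) hR hsimple K
        (HopfMod.mult_eq_of_basis_quotient Q K hQK b)
      exact Module.Free.of_basis c
    · exact hfree hM
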